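/- **Environment.** A finite random set $C\subset\mathbb N$ of potential coordinators is drawn from a distribution $\beta_C$ with $\Pr(|C|\le 1)=0$. Every potential coordinator $c$ has $\kappa$ potential agents $(c,1),\dots,(c,\kappa)$; the set $A_c$ of those who are actually present is drawn from a distribution $\beta_A$ on the subsets of $\{1,\dots,\kappa\}$ with $\Pr(A_c=\varnothing)=0$. Valuations have an atomless law on $[0,\infty)$ with distribution function $F$. The set $C$, the sets $A_c$ and all valuations are independent. The agents present are those of the coordinators in $C$. Each of them knows his valuation $v$ and the number $k=|A_c|$ of agents of his coordinator; this pair is his type. If $k\ge 2$, these agents are invited to form a bidding club; if $k=1$, the agent is a non-member. Let $\gamma_A$ be the law of $|A_c|$, and let $P^{n,k}=(p^{n,k}_m)_m$ be the law of $k+X_1+\dots+X_{n-1}$ with $X_1,X_2,\dots$ independent with law $\gamma_A$. **Equilibrium bids.** For $j\ge 2$ let $b^e(v,j)=v-F(v)^{-(j-1)}\int_0^vF(u)^{j-1}\,du$, and for a distribution $P=(p_j)$ of the number of bidders let $$b^e(v,P)=\sum_{j\ge2}\frac{p_jF(v)^{j-1}}{\sum_{l\ge2}p_lF(v)^{l-1}}\,b^e(v,j)\qquad(\text{and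 } b^e(v,P)=0\text{ if }F(v)=0).$$ **Game.** An invited agent either accepts, and reports a valuation $\mu_i\in\mathbb R$ to his coordinator, or declines. Non-members and decliners either register in the main auction or stay out. The auctioneer announces the number $n$ of registered bidders, then bids are placed, and those who registered on their own may let their bid depend on $n$. The highest bidder gets the good and pays his bid (ties are broken uniformly at random). A coordinator with $k\ge2$ agents acts as follows. If at least one of them declines, he registers all agents $i$ who accepted and bids $b^e(\mu_i,P^{n,k})$ for each. If all accept, he registers only an agent $h$ with the highest report (the one of lowest index among equal reports) and bids $b^e(\mu_h,P^{n,1})$ for him; if $h$ wins, he pays in addition $b^e(\mu_h,P^{n,k})-b^e(\mu_h,P^{n,1})$ to the coordinator. The winner's utility is his valuation minus his payments, and that of all others is $0$. **Theorem.** For all $n\ge2$ and $k\ge1$, $b^e(\cdot,P^{n,k})$ is a symmetric equilibrium of the ordinary first-price auction in which the number of bidders is distributed according to $P^{n,k}$ and valuations are independent with distribution function $F$. Moreover, it is a Bayes–Nash equilibrium of the bidding-club game that every invited agent accepts the invitation and reports his valuation truthfully, and that every non-member registers and bids $b^e(v,P^{n,1})$, where $n$ is the announced number of bidders: for every agent and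 each of his types $(v,k)$, $v\ge0$, no other strategy gives a higher expected utility, conditional on his being present and on his type, when all others behave as described. -/

import Mathlib

open MeasureTheory ProbabilityTheory
open scoped ENNReal

noncomputable section

namespace BiddingClubs

/-! ### Equilibrium bids -/

/-- `b^e(v, j)`: the equilibrium bid of an agent with valuation `v` in the classical first-price
auction with `j` bidders whose valuations are independent with distribution function `F`. -/
def bidFixed (F : ℝ → ℝ) (v : ℝ) (j : ℕ) : ℝ :=
  v - (F v ^ (j - 1))⁻¹ * ∫ u in (0 : ℝ)..v, F u ^ (j - 1)

/-- `∑_{j ≥ 2} p_j F(v)^{j-1}`: the probability that all the other bidders have valuation at most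
`v`, when the number of bidders has distribution `P`. -/
def topProb (F : ℝ → ℝ) (v : ℝ) (P : PMF ℕ) : ℝ :=
  ∑' j : ℕ, if 2 ≤ j then (P j).toReal * F v ^ (j - 1) else 0

/-- `b^e(v, P)`: the equilibrium bid of an agent with valuation `v` in the first-price auction with
a stochastic number of bidders, distributed according to `P`. It is the mean of the bids
`b^e(v, j)`, `j ≥ 2`, with weights proportional to `p_j F(v)^{j-1}`. (It is `0` when
`F v = 0`.) -/
def bidStoch (F : ℝ → ℝ) (v : ℝ) (P : PMF ℕ) : ℝ :=
  ∑' j : ℕ, if 2 ≤ j then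
    (P j).toReal * F v ^ (j - 1) / topProb F v P * bidFixed F v j else 0

/-- Utility of a bidder with valuation `v` and bid `x` in a sealed-bid first-price auction in which
the other bids are `y`, ties being broken uniformly at random. -/
def firstPriceUtility (v x : ℝ) {m : ℕ} (y : Fin m → ℝ) : ℝ :=
  open Classical in
  if ∀ l, y l ≤ x then (v - x) / (1 + (Finset.univ.filter fun l => y l = x).card : ℕ) else 0

/-- Expected utility of an agent with valuation `v` who bids `x` in the first-price auction with a
stochastic number of bidders, distributed according to `P`, valuations being independent with law
`μ`, when every other agent bids `b` of his valuation. -/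
def stochUtility (μ : Measure ℝ) (P : PMF ℕ) (b : ℝ → ℝ) (v x : ℝ) : ℝ :=
  ∑' j : ℕ, if 2 ≤ j then
    (P j).toReal *
      ∫ w : Fin (j - 1) → ℝ, firstPriceUtility v x (fun l => b (w l)) ∂(Measure.pi fun _ => μ)
    else 0

/-- `b` is a symmetric equilibrium of the first-price auction with a stochastic number of
bidders. -/
def IsSymmetricEquilibrium (μ : Measure ℝ) (P : PMF ℕ) (b : ℝ → ℝ) : Prop :=
  ∀ v, 0 ≤ v → ∀ x, stochUtility μ P b v x ≤ stochUtility μ P b v (b v)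

/-! ### The economic environment -/

/-- The law of the sum of `m` independent numbers drawn from `γ`. -/
def iidSum (γ : PMF ℕ) : ℕ → PMF ℕ
  | 0 => PMF.pure 0
  | m + 1 => (iidSum γ m).bind fun s => γ.map fun t => s + t

/-- `P^{n,k}`: the law of the total number of agents when there are `n` potential coordinators, one
of which has exactly `k` agents, while the numbers of agents of the others are independently drawn
from `γ`. -/
def belief (γ : PMF ℕ) (n k : ℕ) : PMF ℕ :=
  (iidSum γ (n - 1)).map fun s => k + s

/-- A potential agent: the pair `(c, a)` is the `a`-th potential agent of the potential
coordinator `c`. Each coordinator has `κ` potential agents. -/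
abbrev Agent (κ : ℕ) : Type := ℕ × Fin κ

/-- A state of the world: the set of selected potential coordinators, the set of agents selected for
each potential coordinator, and the valuations. -/
abbrev State (κ : ℕ) : Type := Finset ℕ × (ℕ → Finset (Fin κ)) × (Agent κ → ℝ)

/-- The prior: the set of coordinators is drawn from `βC`, the sets of agents of the coordinators
are drawn from `βA` and the valuations from `μ`, everything independently. -/
def prior {κ : ℕ} (βC : PMF (Finset ℕ)) (βA : PMF (Finset (Fin κ))) (μ : Measure ℝ)
    [IsProbabilityMeasure μ] : Measure (State κ) :=
  βC.toMeasure.prod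
    ((Measure.infinitePi fun _ : ℕ => βA.toMeasure).prod
      (Measure.infinitePi fun _ : Agent κ => μ))

/-- The event that agent `i` is selected and that there are `k` agents in his club, himself
included. -/
def selected {κ : ℕ} (i : Agent κ) (k : ℕ) : Set (State κ) :=
  {ω | i.1 ∈ ω.1 ∧ i.2 ∈ ω.2.1 i.1 ∧ (ω.2.1 i.1).card = k}

/-! ### Actions and the augmented auction mechanism -/

/-- What an agent may do: stay out of everything; register in the main auction on his own and, when
the auctioneer has announced the number `n` of registered bidders, bid `bid n`; or accept the
invitation of his coordinator and report the valuation `report`. The first two are the ways of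
declining an invitation. -/
inductive Action : Type
  | abstain : Action
  | direct (bid : ℕ → ℝ) : Action
  | join (report : ℝ) : Action

/-- The agent accepts the invitation. -/
def Action.IsJoin : Action → Prop
  | .join _ => True
  | _ => False

/-- The reported valuation (relevant only for those who accept the invitation). -/
def Action.report : Action → ℝ
  | .join r => r
  | _ => 0

/-- A strategy maps the type of an agent, that is, his valuation and the number of agents in his
club, to an action. -/
abbrev Strategy : Type := ℝ → ℕ → Action

/-- There is a club to join only if it has at least two agents. -/
def Strategy.Feasible (s : Strategy) : Prop :=
  ∀ v k, (s v k).IsJoin → 2 ≤ k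

section Mechanism

variable {κ : ℕ} (F : ℝ → ℝ) (γ : PMF ℕ) (C : Finset ℕ) (A : ℕ → Finset (Fin κ))
  (act : Agent κ → Action)

/-- All agents of coordinator `c` accepted the invitation. -/
def AllJoin (c : ℕ) : Prop :=
  ∀ a ∈ A c, (act (c, a)).IsJoin

/-- Agent `i` has the highest report among the agents of his coordinator (among several agents with
the same highest report the one with the lowest index is taken). -/
def IsTop (i : Agent κ) : Prop :=
  ∀ a ∈ A i.1, (act (i.1, a)).report < (act i).report ∨
    ((act (i.1, a)).report = (act i).report ∧ i.2 ≤ a)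

/-- The agents who are registered in the main auction. If all agents of a club accepted the
invitation, then the coordinator drops all of them but the one with the highest report. Otherwise
the coordinator registers all those who accepted, and those who declined register or not, as they
choose. -/
def bidders : Finset (Agent κ) :=
  open Classical in
  (C ×ˢ (Finset.univ : Finset (Fin κ))).filter fun i =>
    i.2 ∈ A i.1 ∧ if AllJoin A act i.1 then IsTop A act i else act i ≠ Action.abstain

/-- The number of bidders that the auctioneer announces. -/
def announced : ℕ := (bidders C A act).card

/-- The bid placed in the main auction by, or on behalf of, the registered agent `i`. -/
def mainBid (i : Agent κ) : ℝ :=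
  open Classical in
  match act i with
  | .abstain => 0
  | .direct b => b (announced C A act)
  | .join r =>
      if AllJoin A act i.1 then bidStoch F r (belief γ (announced C A act) 1)
      else bidStoch F r (belief γ (announced C A act) (A i.1).card)

/-- The additional payment that agent `i` makes to his coordinator if he wins. -/
def clubPayment (i : Agent κ) : ℝ :=
  open Classical in
  match act i with
  | .join r =>
      if AllJoin A act i.1 then
        bidStoch F r (belief γ (announced C A act) (A i.1).card)
          - bidStoch F r (belief γ (announced C A act) 1)
      else 0
  | _ => 0

/-- The registered agents with the highest bid. -/
def winners : Finset (Agent κ) :=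
  open Classical in
  (bidders C A act).filter fun i =>
    ∀ j ∈ bidders C A act, mainBid F γ C A act j ≤ mainBid F γ C A act i

/-- The utility of agent `i` if his valuation is `v`. Ties in the main auction are broken uniformly
at random, and the utility is the expectation over this lottery. The winner pays his bid to the
auctioneer and the club payment to his coordinator. -/
def utility (v : ℝ) (i : Agent κ) : ℝ :=
  open Classical in
  if i ∈ winners F γ C A act then
    (v - mainBid F γ C A act i - clubPayment F γ C A act i) / (winners F γ C A act).card
  else 0

end Mechanism

/-! ### The Bayesian game -/

/-- The expectation of `u`, with values in `[-∞, ∞]`. -/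
def expectation {Ω : Type} [MeasurableSpace Ω] (P : Measure Ω) (u : Ω → ℝ) : EReal :=
  ((∫⁻ ω, ENNReal.ofReal (u ω) ∂P : ℝ≥0∞) : EReal)
    - ((∫⁻ ω, ENNReal.ofReal (-u ω) ∂P : ℝ≥0∞) : EReal)

/-- The expected utility of agent `i` of type `(v, k)` if he takes the action `d` and the other
agents follow the strategies `σ`. It is computed under the prior conditioned on the event that `i`
is selected and has `k` agents in his club; his own valuation is independent of the rest of the
state, and is fixed to be `v`. -/
def interimUtility {κ : ℕ} (βC : PMF (Finset ℕ)) (βA : PMF (Finset (Fin κ))) (μ : Measure ℝ)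
    [IsProbabilityMeasure μ] (σ : Agent κ → Strategy) (i : Agent κ) (v : ℝ) (k : ℕ)
    (d : Action) : EReal :=
  expectation ((prior βC βA μ)[|selected i k]) fun ω =>
    utility (cdf μ) (βA.map Finset.card) ω.1 ω.2.1
      (Function.update (fun j => σ j (ω.2.2 j) (ω.2.1 j.1).card) i d) v i

/-- `σ` is a Bayes–Nash equilibrium: all strategies are feasible and, for every agent and each of
his types, no feasible strategy gives him a higher expected utility. -/
def IsBayesNash {κ : ℕ} (βC : PMF (Finset ℕ)) (βA : PMF (Finset (Fin κ))) (μ : Measure ℝ)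
    [IsProbabilityMeasure μ] (σ : Agent κ → Strategy) : Prop :=
  (∀ i, (σ i).Feasible) ∧
    ∀ (i : Agent κ) (v : ℝ) (k : ℕ), 0 ≤ v → ∀ s : Strategy, s.Feasible →
      interimUtility βC βA μ σ i v k (s v k) ≤ interimUtility βC βA μ σ i v k (σ i v k)

/-- Invited agents accept the invitation and report truthfully; an agent who is not in a club
registers and bids `b^e(v, P^{n,1})`, where `n` is the announced number of bidders. -/
def clubStrategy (F : ℝ → ℝ) (γ : PMF ℕ) : Strategy := fun v k =>
  if 2 ≤ k then Action.join v else Action.direct fun n => bidStoch F v (belief γ n 1)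

end BiddingClubs

end

/-!
With `G v` the probability that all rivals have valuations at most `v`, a first-price bid shaded to
`v - (∫₀ᵛ G) / G v` leaves a bidder the surplus `∫₀ᵛ G`, and since `G` is monotone, no other bid
leaves him more. The bids `b^e(·, P)` have this form, with `G = ∑ p_j F ^ (j - 1)`.

If there are `n` coordinators and everyone follows the equilibrium, then `n` bidders are announced,
and a member of a club with `k` agents who wins pays `b^e(v, P^{n,k})` in total. He wins if and only
if his valuation is the highest one, so that he faces the auction with `P^{n,k}` bidders, and a
false report amounts to a false bid in that auction. If he declines, the announced number rises to
`n + k - 1`, and the other members are registered and bid `b^e(·, P^{n+k-1,k})`, while the other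
clubs bid `b^e(·, P^{n+k-1,1})`. Neither is below `b^e(·, P^{n,k})`: writing `g` for the generating
function of the number of agents in a club, the probability `G` of `P^{n,k}` is
`F ^ (k - 1) * g(F) ^ (n - 1)`, and since `g(s) / s` is nondecreasing, replacing rival agents by
rival clubs makes `G` steeper. So declining is no better than making the same bid in the auction
with `P^{n,k}` bidders.
-/

noncomputable section

namespace BiddingClubs

/-! ### Bids generated by a winning probability -/

/-- The probability `G v` of winning an auction as a function of the valuation that the bidder
pretends to have. -/
structure IsWinProb (G : ℝ → ℝ) : Prop where
  mono : Monotone G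
  eq_zero_of_nonpos : ∀ v ≤ 0, G v = 0

/-- The equilibrium bid of an agent with valuation `v` in a first-price auction which is won with
probability `G u` when bidding like an agent with valuation `u`: the valuation is shaded by the
information rent `∫ G` per unit of winning probability. The bid is set to `0` where `G` vanishes. -/
def shadedBid (G : ℝ → ℝ) (v : ℝ) : ℝ :=
  open Classical in if G v = 0 then 0 else v - (G v)⁻¹ * ∫ u in (0 : ℝ)..v, G u

section ShadedBid

variable {G H : ℝ → ℝ}

lemma mul_sub_le_integral_of_monotone (hG : Monotone G) (a b : ℝ) :
    G a * (b - a) ≤ ∫ u in a..b, G u := by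
  have hint (a b : ℝ) : IntervalIntegrable G volume a b := hG.intervalIntegrable
  rcases le_total a b with hab | hba
  · have h := intervalIntegral.integral_mono_on hab intervalIntegrable_const (hint a b)
      fun u hu => hG hu.1
    simpa [mul_comm] using h
  · have h := intervalIntegral.integral_mono_on hba (hint b a) intervalIntegrable_const
      fun u hu => hG hu.2
    rw [intervalIntegral.integral_symm]
    simp only [intervalIntegral.integral_const, smul_eq_mul] at h
    linarith

lemma IsWinProb.nonneg (hG : IsWinProb G) (v : ℝ) : 0 ≤ G v :=
  (hG.eq_zero_of_nonpos _ (min_le_right v 0)).symm.trans_le (hG.mono (min_le_left v 0))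

lemma IsWinProb.pos_of_ne_zero (hG : IsWinProb G) {v : ℝ} (hv : G v ≠ 0) : 0 < v :=
  not_le.1 fun h => hv (hG.eq_zero_of_nonpos v h)

lemma shadedBid_of_eq_zero {v : ℝ} (hv : G v = 0) : shadedBid G v = 0 := if_pos hv

lemma IsWinProb.integral_eq_zero (hG : IsWinProb G) {v : ℝ} (hv : G v = 0) :
    ∫ u in (0 : ℝ)..v, G u = 0 := by
  refine intervalIntegral.integral_zero_ae (.of_forall fun u hu => ?_)
  have hle : G u ≤ 0 := by
    rcases (Set.mem_uIoc.1 hu) with h | h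
    · exact hv ▸ hG.mono h.2
    · exact (hG.eq_zero_of_nonpos u h.2).le
  exact hle.antisymm (hG.nonneg u)

lemma IsWinProb.mul_sub_shadedBid (hG : IsWinProb G) (v : ℝ) :
    G v * (v - shadedBid G v) = ∫ u in (0 : ℝ)..v, G u := by
  by_cases hv : G v = 0
  · rw [hG.integral_eq_zero hv, hv, zero_mul]
  · rw [shadedBid, if_neg hv]
    field_simp
    ring

lemma IsWinProb.payoff_le (hG : IsWinProb G) (v r : ℝ) :
    G r * (v - shadedBid G r) ≤ G v * (v - shadedBid G v) := by
  have hint (a b : ℝ) : IntervalIntegrable G volume a b := hG.mono.intervalIntegrable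
  calc G r * (v - shadedBid G r)
      = (∫ u in (0 : ℝ)..r, G u) + G r * (v - r) := by rw [← hG.mul_sub_shadedBid]; ring
    _ ≤ (∫ u in (0 : ℝ)..r, G u) + ∫ u in r..v, G u := by
        gcongr
        exact mul_sub_le_integral_of_monotone hG.mono r v
    _ = G v * (v - shadedBid G v) := by
        rw [intervalIntegral.integral_add_adjacent_intervals (hint 0 r) (hint r v),
          hG.mul_sub_shadedBid]

lemma IsWinProb.payoff_nonneg (hG : IsWinProb G) (v : ℝ) : 0 ≤ G v * (v - shadedBid G v) := by
  simpa [hG.eq_zero_of_nonpos 0 le_rfl] using hG.payoff_le v 0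

lemma IsWinProb.shadedBid_le_self (hG : IsWinProb G) {v : ℝ} (hv : 0 ≤ v) :
    shadedBid G v ≤ v := by
  rcases (hG.nonneg v).eq_or_lt with h | h
  · rwa [shadedBid_of_eq_zero h.symm]
  · exact sub_nonneg.1 (nonneg_of_mul_nonneg_right (hG.payoff_nonneg v) h)

lemma IsWinProb.shadedBid_lt_self (hG : IsWinProb G) {x y : ℝ} (hy : 0 < G y) (hyx : y < x) :
    shadedBid G x < x := by
  have hb : shadedBid G y ≤ y := hG.shadedBid_le_self (hG.pos_of_ne_zero hy.ne').le
  have hpay : 0 < G x * (x - shadedBid G x) :=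
    (mul_pos hy (by linarith)).trans_le (hG.payoff_le x y)
  exact sub_pos.1 (pos_of_mul_pos_right hpay (hG.nonneg x))

lemma IsWinProb.sub_mul_le_mul_shadedBid_sub (hG : IsWinProb G) (r w : ℝ) :
    (G w - G r) * (r - shadedBid G r) ≤ G w * (shadedBid G w - shadedBid G r) := by
  have h := hG.payoff_le r w
  linarith

lemma IsWinProb.shadedBid_le_of_nonneg (hG : IsWinProb G) {r w : ℝ} (hr : 0 ≤ r) (hrw : r ≤ w) :
    shadedBid G r ≤ shadedBid G w := by
  rcases (hG.nonneg w).eq_or_lt with h | h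
  · have hr0 : G r = 0 := ((hG.mono hrw).trans_eq h.symm).antisymm (hG.nonneg r)
    rw [shadedBid_of_eq_zero hr0, shadedBid_of_eq_zero h.symm]
  · have hgain : 0 ≤ (G w - G r) * (r - shadedBid G r) :=
      mul_nonneg (sub_nonneg.2 (hG.mono hrw)) (sub_nonneg.2 (hG.shadedBid_le_self hr))
    exact sub_nonneg.1
      (nonneg_of_mul_nonneg_right (hgain.trans (hG.sub_mul_le_mul_shadedBid_sub r w)) h)

lemma IsWinProb.monotone_shadedBid (hG : IsWinProb G) : Monotone (shadedBid G) := by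
  have hmax (v : ℝ) : shadedBid G v = shadedBid G (max v 0) := by
    rcases le_total v 0 with h | h
    · rw [max_eq_right h, shadedBid_of_eq_zero (hG.eq_zero_of_nonpos v h),
        shadedBid_of_eq_zero (hG.eq_zero_of_nonpos 0 le_rfl)]
    · rw [max_eq_left h]
  intro r w hrw
  rw [hmax r, hmax w]
  exact hG.shadedBid_le_of_nonneg (le_max_right r 0) (max_le_max_right 0 hrw)

lemma IsWinProb.shadedBid_nonneg (hG : IsWinProb G) (v : ℝ) : 0 ≤ shadedBid G v := by
  rw [← shadedBid_of_eq_zero (hG.eq_zero_of_nonpos _ (min_le_right v 0))]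
  exact hG.monotone_shadedBid (min_le_left v 0)

lemma IsWinProb.shadedBid_lt_of_lt (hG : IsWinProb G) (hc : Continuous G) {r w : ℝ}
    (h : G r < G w) : shadedBid G r < shadedBid G w := by
  have hivt {s t : ℝ} (hst : G s < G t) : ∃ x, G s < G x ∧ G x < G t := by
    obtain ⟨z, hz⟩ := exists_between hst
    obtain ⟨x, rfl⟩ := mem_range_of_exists_le_of_exists_ge hc ⟨s, hz.1.le⟩ ⟨t, hz.2.le⟩
    exact ⟨x, hz⟩
  obtain ⟨y, hry, hyw⟩ := hivt h
  obtain ⟨x, hyx, hxw⟩ := hivt hyw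
  have hx : shadedBid G x < x :=
    hG.shadedBid_lt_self ((hG.nonneg r).trans_lt hry) (hG.mono.reflect_lt hyx)
  have hgain : 0 < G w * (shadedBid G w - shadedBid G x) :=
    (mul_pos (sub_pos.2 hxw) (sub_pos.2 hx)).trans_le (hG.sub_mul_le_mul_shadedBid_sub x w)
  calc shadedBid G r
      ≤ shadedBid G x := hG.monotone_shadedBid (hG.mono.reflect_lt (hry.trans hyx)).le
    _ < shadedBid G w := sub_pos.1 (pos_of_mul_pos_right hgain (hG.nonneg w))

lemma IsWinProb.shadedBid_le_shadedBid (hG : IsWinProb G) (hH : IsWinProb H) {v : ℝ}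
    (hne : G v ≠ 0 → H v ≠ 0) (hcross : ∀ u ∈ Set.Icc 0 v, H u * G v ≤ H v * G u) :
    shadedBid G v ≤ shadedBid H v := by
  by_cases hv : G v = 0
  · exact (shadedBid_of_eq_zero hv).trans_le (hH.shadedBid_nonneg v)
  have hGv : 0 < G v := (hG.nonneg v).lt_of_ne' hv
  have hHv : 0 < H v := (hH.nonneg v).lt_of_ne' (hne hv)
  have hint : (∫ u in (0 : ℝ)..v, H u) * G v ≤ H v * ∫ u in (0 : ℝ)..v, G u := by
    rw [← intervalIntegral.integral_mul_const, ← intervalIntegral.integral_const_mul]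
    exact intervalIntegral.integral_mono_on (hG.pos_of_ne_zero hv).le
      (hH.mono.intervalIntegrable.mul_const _) (hG.mono.intervalIntegrable.const_mul _) hcross
  rw [← hG.mul_sub_shadedBid, ← hH.mul_sub_shadedBid] at hint
  have hrent : v - shadedBid H v ≤ v - shadedBid G v :=
    le_of_mul_le_mul_left (by linarith) (mul_pos hGv hHv)
  linarith

end ShadedBid

/-! ### A random number of bidders -/

/-- The probability of `j` bidders, counted only if there are at least two of them. -/
def bidderWeight (P : PMF ℕ) (j : ℕ) : ℝ :=
  if 2 ≤ j then (P j).toReal else 0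

/-- The probability that all the other bidders have a valuation in a set of probability `s`, when
the number of bidders, at least two, is distributed according to `P`. -/
def topWeight (P : PMF ℕ) (s : ℝ) : ℝ :=
  ∑' j, bidderWeight P j * s ^ (j - 1)

section RandomBidders

variable (P : PMF ℕ) {F : ℝ → ℝ} {s : ℝ}

lemma bidderWeight_of_le {j : ℕ} (hj : 2 ≤ j) : bidderWeight P j = (P j).toReal := if_pos hj

lemma bidderWeight_of_lt {j : ℕ} (hj : j < 2) : bidderWeight P j = 0 := if_neg hj.not_ge

lemma bidderWeight_nonneg (j : ℕ) : 0 ≤ bidderWeight P j := by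
  unfold bidderWeight
  split_ifs <;> simp

lemma summable_bidderWeight : Summable (bidderWeight P) := by
  have hP : Summable fun j => (P j).toReal := ENNReal.summable_toReal P.tsum_coe_ne_top
  refine hP.of_nonneg_of_le (bidderWeight_nonneg P) fun j => ?_
  unfold bidderWeight
  split_ifs <;> simp

lemma norm_bidderWeight_mul_pow_le (hs : s ∈ Set.Icc (0 : ℝ) 1) (j : ℕ) :
    ‖bidderWeight P j * s ^ (j - 1)‖ ≤ bidderWeight P j := by
  rw [Real.norm_of_nonneg (mul_nonneg (bidderWeight_nonneg P j) (pow_nonneg hs.1 _))]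
  exact mul_le_of_le_one_right (bidderWeight_nonneg P j) (pow_le_one₀ hs.1 hs.2)

lemma summable_bidderWeight_mul_pow (hs : s ∈ Set.Icc (0 : ℝ) 1) :
    Summable fun j => bidderWeight P j * s ^ (j - 1) :=
  (summable_bidderWeight P).of_norm_bounded (norm_bidderWeight_mul_pow_le P hs)

lemma topWeight_zero : topWeight P 0 = 0 := by
  refine (tsum_congr fun j => ?_).trans tsum_zero
  rcases lt_or_ge j 2 with hj | hj
  · rw [bidderWeight_of_lt P hj, zero_mul]
  · rw [zero_pow (by omega), mul_zero]

lemma monotoneOn_topWeight : MonotoneOn (topWeight P) (Set.Icc 0 1) := fun _ hs _ ht hst =>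
  (summable_bidderWeight_mul_pow P hs).tsum_le_tsum
    (fun j => mul_le_mul_of_nonneg_left (pow_le_pow_left₀ hs.1 hst _) (bidderWeight_nonneg P j))
    (summable_bidderWeight_mul_pow P ht)

lemma topWeight_nonneg (hs : 0 ≤ s) : 0 ≤ topWeight P s :=
  tsum_nonneg fun j => mul_nonneg (bidderWeight_nonneg P j) (pow_nonneg hs _)

variable {P} in
lemma strictMonoOn_topWeight (hP : ∃ j, 2 ≤ j ∧ P j ≠ 0) :
    StrictMonoOn (topWeight P) (Set.Icc 0 1) := by
  obtain ⟨j, hj, hPj⟩ := hP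
  intro s hs t ht hst
  have hw : 0 < bidderWeight P j :=
    (bidderWeight_of_le P hj).symm ▸ ENNReal.toReal_pos hPj (P.apply_ne_top j)
  refine (summable_bidderWeight_mul_pow P hs).tsum_lt_tsum (i := j)
    (fun i => mul_le_mul_of_nonneg_left (pow_le_pow_left₀ hs.1 hst.le _) (bidderWeight_nonneg P i))
    (mul_lt_mul_of_pos_left (pow_lt_pow_left₀ hst hs.1 (by omega)) hw)
    (summable_bidderWeight_mul_pow P ht)

lemma continuousOn_topWeight : ContinuousOn (topWeight P) (Set.Icc 0 1) :=
  continuousOn_tsum (fun _ => (continuous_const.mul (continuous_pow _)).continuousOn)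
    (summable_bidderWeight P) fun j _ hs => norm_bidderWeight_mul_pow_le P hs j

lemma topProb_eq_topWeight (v : ℝ) : topProb F v P = topWeight P (F v) :=
  tsum_congr fun j => by
    unfold bidderWeight
    split_ifs <;> simp

lemma isWinProb_topWeight (hF : IsWinProb F) (hF1 : ∀ v, F v ≤ 1) :
    IsWinProb fun v => topWeight P (F v) where
  mono u v huv :=
    monotoneOn_topWeight P ⟨hF.nonneg u, hF1 u⟩ ⟨hF.nonneg v, hF1 v⟩ (hF.mono huv)
  eq_zero_of_nonpos v hv := by rw [hF.eq_zero_of_nonpos v hv, topWeight_zero]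

lemma hasSum_integral_topWeight (hF : IsWinProb F) (hF1 : ∀ v, F v ≤ 1) (v : ℝ) :
    HasSum (fun j => bidderWeight P j * ∫ u in (0 : ℝ)..v, F u ^ (j - 1))
      (∫ u in (0 : ℝ)..v, topWeight P (F u)) := by
  have hmem (u : ℝ) : F u ∈ Set.Icc (0 : ℝ) 1 := ⟨hF.nonneg u, hF1 u⟩
  simp_rw [← intervalIntegral.integral_const_mul]
  refine intervalIntegral.hasSum_integral_of_dominated_convergence
    (fun j _ => bidderWeight P j) (fun j => ?_) (fun j => ?_) (.of_forall fun _ _ => ?_)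
    intervalIntegrable_const (.of_forall fun u _ => ?_)
  · exact ((hF.mono.measurable.pow_const _).const_mul _).aestronglyMeasurable
  · exact .of_forall fun u _ => norm_bidderWeight_mul_pow_le P (hmem u) j
  · exact summable_bidderWeight P
  · exact (summable_bidderWeight_mul_pow P (hmem u)).hasSum

lemma bidStoch_eq_shadedBid (hF : IsWinProb F) (hF1 : ∀ v, F v ≤ 1) (v : ℝ) :
    bidStoch F v P = shadedBid (fun u => topWeight P (F u)) v := by
  unfold bidStoch shadedBid
  rw [topProb_eq_topWeight]
  split_ifs with h
  · simp [h]
  have hFv : F v ≠ 0 := fun h0 => h (by simp only [h0, topWeight_zero])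
  have hterm (j : ℕ) :
      (if 2 ≤ j then (P j).toReal * F v ^ (j - 1) / topWeight P (F v) * bidFixed F v j else 0) =
        (topWeight P (F v))⁻¹ * (bidderWeight P j * F v ^ (j - 1) * v
          - bidderWeight P j * ∫ u in (0 : ℝ)..v, F u ^ (j - 1)) := by
    unfold bidderWeight bidFixed
    split_ifs
    · field_simp
    · simp
  have hsum := ((summable_bidderWeight_mul_pow P ⟨hF.nonneg v, hF1 v⟩).hasSum.mul_right v).sub
    (hasSum_integral_topWeight P hF hF1 v)
  rw [tsum_congr hterm, (hsum.mul_left _).tsum_eq, mul_sub, ← topWeight,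
    inv_mul_cancel_left₀ h]

end RandomBidders

/-! ### Generating functions -/

/-- The probability generating function of `γ`, with values in `[0, ∞]`. -/
def pgf (γ : PMF ℕ) (s : ℝ≥0∞) : ℝ≥0∞ := ∑' j, γ j * s ^ j

/-- The probability that all the rivals of a bidder in a club with `k` agents have valuations in a
set of probability `s`, when there are `n` coordinators. -/
def rivalWeight (γ : PMF ℕ) (n k : ℕ) (s : ℝ≥0∞) : ℝ≥0∞ := s ^ (k - 1) * pgf γ s ^ (n - 1)

lemma tsum_bind_mul {α β : Type*} (p : PMF α) (f : α → PMF β) (g : β → ℝ≥0∞) :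
    ∑' b, p.bind f b * g b = ∑' a, p a * ∑' b, f a b * g b := by
  simp_rw [PMF.bind_apply, ← ENNReal.tsum_mul_right, ← ENNReal.tsum_mul_left, mul_assoc]
  exact ENNReal.tsum_comm

lemma tsum_pure_mul {α : Type*} (a : α) (g : α → ℝ≥0∞) : ∑' b, PMF.pure a b * g b = g a := by
  rw [tsum_eq_single a fun b hb => by rw [PMF.pure_apply_of_ne _ _ hb, zero_mul],
    PMF.pure_apply_self, one_mul]

lemma tsum_map_mul {α β : Type*} (p : PMF α) (f : α → β) (g : β → ℝ≥0∞) :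
    ∑' b, p.map f b * g b = ∑' a, p a * g (f a) := by
  simp_rw [PMF.map, tsum_bind_mul, Function.comp_apply, tsum_pure_mul]

section Pgf

variable (γ : PMF ℕ) {s t : ℝ≥0∞}

lemma pgf_zero : pgf γ 0 = γ 0 := by
  rw [pgf, tsum_eq_single 0 fun j hj => by rw [zero_pow hj, mul_zero], pow_zero, mul_one]

lemma pgf_mono : Monotone (pgf γ) := fun _ _ hst =>
  ENNReal.tsum_le_tsum fun _ => by gcongr

lemma pgf_one : pgf γ 1 = 1 := by simp [pgf]

lemma pgf_ne_top (hs : s ≤ 1) : pgf γ s ≠ ∞ :=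
  ((pgf_mono γ hs).trans_eq (pgf_one γ)).trans_lt ENNReal.one_lt_top |>.ne

lemma pgf_iidSum (m : ℕ) : pgf (iidSum γ m) s = pgf γ s ^ m := by
  induction m with
  | zero => simp [pgf, iidSum]
  | succ m ih =>
    calc pgf (iidSum γ (m + 1)) s
        = ∑' a, iidSum γ m a * (s ^ a * pgf γ s) := by
          simp_rw [pgf, iidSum, tsum_bind_mul, tsum_map_mul, pow_add, ← ENNReal.tsum_mul_left,
            mul_left_comm]
      _ = pgf γ s ^ (m + 1) := by
          simp_rw [← mul_assoc, ENNReal.tsum_mul_right]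
          rw [← pgf, ih, pow_succ]

lemma pgf_map_card {α : Type*} (β : PMF (Finset α)) :
    pgf (β.map Finset.card) s = ∑' B, β B * s ^ B.card :=
  tsum_map_mul β Finset.card fun j => s ^ j

variable {γ}

lemma pgf_mul_le_pgf_mul (hγ : γ 0 = 0) (hst : s ≤ t) : pgf γ s * t ≤ pgf γ t * s := by
  simp_rw [pgf, ← ENNReal.tsum_mul_right]
  refine ENNReal.tsum_le_tsum fun j => ?_
  cases j with
  | zero => simp [hγ]
  | succ j =>
    calc γ (j + 1) * s ^ (j + 1) * t = γ (j + 1) * (s ^ j * (s * t)) := by ring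
      _ ≤ γ (j + 1) * (t ^ j * (s * t)) := by gcongr
      _ = γ (j + 1) * t ^ (j + 1) * s := by ring

lemma belief_apply_eq_zero (hγ : γ 0 = 0) {n k j : ℕ} (hn : 2 ≤ n) (hk : 1 ≤ k) (hj : j < 2) :
    belief γ n k j = 0 := by
  have hsum : iidSum γ (n - 1) 0 = 0 := by
    rw [← pgf_zero, pgf_iidSum, pgf_zero, hγ, zero_pow (by omega)]
  rw [belief, PMF.map_apply, ENNReal.tsum_eq_zero]
  intro a
  split_ifs with h
  · obtain rfl : a = 0 := by omega
    exact hsum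
  · rfl

lemma exists_two_le_belief_apply_ne_zero (hγ : γ 0 = 0) {n k : ℕ} (hn : 2 ≤ n) (hk : 1 ≤ k) :
    ∃ j, 2 ≤ j ∧ belief γ n k j ≠ 0 := by
  obtain ⟨j, hj⟩ := (belief γ n k).support_nonempty
  refine ⟨j, not_lt.1 fun h => ?_, (PMF.mem_support_iff _ _).1 hj⟩
  exact (PMF.mem_support_iff _ _).1 hj (belief_apply_eq_zero hγ hn hk h)

lemma tsum_belief_mul_pow {n k : ℕ} (hk : 1 ≤ k) :
    ∑' j, belief γ n k j * s ^ (j - 1) = rivalWeight γ n k s := by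
  rw [belief, tsum_map_mul, rivalWeight, ← pgf_iidSum, pgf, ← ENNReal.tsum_mul_left]
  refine tsum_congr fun a => ?_
  rw [Nat.sub_add_comm hk, pow_add, mul_left_comm]

lemma topWeight_belief (hγ : γ 0 = 0) {n k : ℕ} (hn : 2 ≤ n) (hk : 1 ≤ k) (hs : s ≤ 1) :
    topWeight (belief γ n k) s.toReal = (rivalWeight γ n k s).toReal := by
  have hs_top : s ≠ ∞ := (hs.trans_lt ENNReal.one_lt_top).ne
  rw [← tsum_belief_mul_pow hk, ENNReal.tsum_toReal_eq fun j =>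
    ENNReal.mul_ne_top ((belief γ n k).apply_ne_top j) (ENNReal.pow_ne_top hs_top)]
  refine tsum_congr fun j => ?_
  rw [ENNReal.toReal_mul, ENNReal.toReal_pow]
  rcases lt_or_ge j 2 with hj | hj
  · rw [bidderWeight_of_lt _ hj, belief_apply_eq_zero hγ hn hk hj, ENNReal.toReal_zero]
  · rw [bidderWeight_of_le _ hj]

lemma rivalWeight_ne_top {n k : ℕ} (hs : s ≤ 1) : rivalWeight γ n k s ≠ ∞ :=
  ENNReal.mul_ne_top (ENNReal.pow_ne_top (hs.trans_lt ENNReal.one_lt_top).ne)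
    (ENNReal.pow_ne_top (pgf_ne_top γ hs))

lemma rivalWeight_eq_zero_iff (hγ : γ 0 = 0) {n : ℕ} (hn : 2 ≤ n) (k : ℕ) :
    rivalWeight γ n k s = 0 ↔ pgf γ s = 0 := by
  rw [rivalWeight, mul_eq_zero, pow_eq_zero_iff (n := n - 1) (by omega)]
  refine ⟨fun h => h.elim (fun hs => ?_) id, .inr⟩
  rw [eq_zero_of_pow_eq_zero hs, pgf_zero, hγ]

/- The rivals of a member of a club with `k` agents are the `k - 1` other members and `n - 1` clubs.
Turning each of those `k - 1` members into a club makes the probability of winning steeper in the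
valuation, since `pgf γ s / s` is monotone. -/
lemma rivalWeight_mul_le (hγ : γ 0 = 0) {n : ℕ} (hn : 1 ≤ n) (k l : ℕ) (hst : s ≤ t) :
    rivalWeight γ (n + (k - 1)) l s * rivalWeight γ n k t ≤
      rivalWeight γ (n + (k - 1)) l t * rivalWeight γ n k s := by
  simp only [rivalWeight, Nat.sub_add_comm hn, pow_add]
  calc s ^ (l - 1) * (pgf γ s ^ (n - 1) * pgf γ s ^ (k - 1)) * (t ^ (k - 1) * pgf γ t ^ (n - 1))
      = s ^ (l - 1) * (pgf γ s * t) ^ (k - 1) * (pgf γ s * pgf γ t) ^ (n - 1) := by ring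
    _ ≤ t ^ (l - 1) * (pgf γ t * s) ^ (k - 1) * (pgf γ s * pgf γ t) ^ (n - 1) := by
        have hratio := pgf_mul_le_pgf_mul hγ hst
        gcongr
    _ = t ^ (l - 1) * (pgf γ t ^ (n - 1) * pgf γ t ^ (k - 1)) *
          (s ^ (k - 1) * pgf γ s ^ (n - 1)) := by ring

end Pgf

/-! ### Atomless valuations -/

section Atomless

variable (μ : Measure ℝ) [IsProbabilityMeasure μ]

lemma isLUB_cdf_image {L : Set ℝ} (hL : IsLowerSet L) (hne : L.Nonempty) :
    IsLUB (cdf μ '' L) (μ.real L) := by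
  refine ⟨?_, fun c hc => not_lt.1 fun hlt => ?_⟩
  · rintro _ ⟨x, hx, rfl⟩
    rw [cdf_eq_real]
    exact measureReal_mono (hL.Iic_subset hx)
  have hc0 : 0 ≤ c := (cdf_nonneg μ _).trans (hc (Set.mem_image_of_mem _ hne.some_mem))
  have hcL : ENNReal.ofReal c < μ L := (ENNReal.ofReal_lt_iff_lt_toReal hc0 (by simp)).2 hlt
  obtain ⟨K, hKL, hK, hcK⟩ :=
    hL.ordConnected.measurableSet.exists_lt_isCompact_of_ne_top (by simp) hcL
  obtain ⟨x, hxK, hx⟩ :=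
    hK.exists_isGreatest (nonempty_of_measure_ne_zero (pos_of_gt hcK).ne')
  refine hcK.not_ge ?_
  calc μ K ≤ μ (Set.Iic x) := measure_mono hx
    _ = ENNReal.ofReal (cdf μ x) := (ofReal_cdf μ x).symm
    _ ≤ ENNReal.ofReal c := ENNReal.ofReal_le_ofReal (hc (Set.mem_image_of_mem _ (hKL hxK)))

lemma measureReal_setOf_cdf_le (v : ℝ) : μ.real {u | cdf μ u ≤ cdf μ v} = cdf μ v := by
  have hgreatest : IsGreatest (cdf μ '' {u | cdf μ u ≤ cdf μ v}) (cdf μ v) :=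
    ⟨⟨v, le_refl (cdf μ v), rfl⟩, by rintro _ ⟨u, hu, rfl⟩; exact hu⟩
  exact (isLUB_cdf_image μ (fun a b hba ha => (monotone_cdf μ hba).trans ha)
    ⟨v, le_refl (cdf μ v)⟩).unique hgreatest.isLUB

variable [NullSingletonClass μ]

lemma continuous_cdf : Continuous (cdf μ) := by
  refine continuous_iff_continuousAt.2 fun x => ?_
  rw [(cdf μ).mono.continuousAt_iff_leftLim_eq_rightLim, StieltjesFunction.rightLim_eq]
  have hjump : cdf μ x - Function.leftLim (cdf μ) x ≤ 0 := by
    rw [← ENNReal.ofReal_eq_zero, ← StieltjesFunction.measure_singleton, measure_cdf,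
      measure_singleton]
  exact ((cdf μ).mono.leftLim_le le_rfl).antisymm (sub_nonpos.1 hjump)

lemma measureReal_setOf_cdf_lt (v : ℝ) : μ.real {u | cdf μ u < cdf μ v} = cdf μ v := by
  rcases (cdf_nonneg μ v).eq_or_lt with hv | hv
  · simp [← hv, (cdf_nonneg μ _).not_gt]
  have hmem {t : ℝ} (ht : 0 < t) (htv : t ≤ cdf μ v) : ∃ u, cdf μ u = t := by
    obtain ⟨w, hw⟩ := ((tendsto_cdf_atBot μ).eventually_lt_const ht).exists
    exact mem_range_of_exists_le_of_exists_ge (continuous_cdf μ) ⟨w, hw.le⟩ ⟨v, htv⟩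
  obtain ⟨u, hu⟩ := hmem (half_pos hv) (half_le_self hv.le)
  refine (isLUB_cdf_image μ (fun a b hba ha => (monotone_cdf μ hba).trans_lt ha)
    ⟨u, hu.trans_lt (half_lt_self hv)⟩).unique ⟨?_, fun c hc => le_of_forall_lt fun t ht => ?_⟩
  · rintro _ ⟨w, hw, rfl⟩
    exact le_of_lt hw
  · obtain ⟨t', ht', htv⟩ := exists_between (max_lt hv ht)
    obtain ⟨w, rfl⟩ := hmem ((le_max_left 0 t).trans_lt ht') htv.le
    exact ((le_max_right 0 t).trans_lt ht').trans_le (hc (Set.mem_image_of_mem _ htv))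

lemma isWinProb_cdf (hμ : μ (Set.Iio 0) = 0) : IsWinProb (cdf μ) where
  mono := monotone_cdf μ
  eq_zero_of_nonpos v hv := by
    have hIic : μ (Set.Iic v) = 0 :=
      measure_mono_null (Set.Iic_subset_Iic.2 hv) ((measure_congr Iio_ae_eq_Iic).symm.trans hμ)
    rw [cdf_eq_real, measureReal_def, hIic, ENNReal.toReal_zero]

end Atomless

/-! ### Equilibrium bids for atomless valuations -/

/-- The expected utility in the first-price auction with a random number of bidders, distributed
according to `P`, of an agent with valuation `v` when everybody bids `b^e(·, P)`. -/
def equilibriumSurplus (F : ℝ → ℝ) (v : ℝ) (P : PMF ℕ) : ℝ :=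
  topWeight P (F v) * (v - bidStoch F v P)

section EquilibriumBids

variable {μ : Measure ℝ} [IsProbabilityMeasure μ] [NullSingletonClass μ]
  (hμ : μ (Set.Iio 0) = 0) (P : PMF ℕ)
include hμ

lemma isWinProb_topWeight_cdf : IsWinProb fun u => topWeight P (cdf μ u) :=
  isWinProb_topWeight P (isWinProb_cdf μ hμ) (cdf_le_one μ)

lemma bidStoch_cdf_eq_shadedBid (v : ℝ) :
    bidStoch (cdf μ) v P = shadedBid (fun u => topWeight P (cdf μ u)) v :=
  bidStoch_eq_shadedBid P (isWinProb_cdf μ hμ) (cdf_le_one μ) v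

lemma monotone_bidStoch : Monotone fun v => bidStoch (cdf μ) v P := by
  simp_rw [bidStoch_cdf_eq_shadedBid hμ]
  exact (isWinProb_topWeight_cdf hμ P).monotone_shadedBid

lemma bidStoch_le_self {v : ℝ} (hv : 0 ≤ v) : bidStoch (cdf μ) v P ≤ v := by
  rw [bidStoch_cdf_eq_shadedBid hμ]
  exact (isWinProb_topWeight_cdf hμ P).shadedBid_le_self hv

variable {P} in
lemma bidStoch_lt_of_cdf_lt (hP : ∃ j, 2 ≤ j ∧ P j ≠ 0) {u v : ℝ} (huv : cdf μ u < cdf μ v) :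
    bidStoch (cdf μ) u P < bidStoch (cdf μ) v P := by
  have hF (w : ℝ) : cdf μ w ∈ Set.Icc (0 : ℝ) 1 := ⟨cdf_nonneg μ w, cdf_le_one μ w⟩
  rw [bidStoch_cdf_eq_shadedBid hμ, bidStoch_cdf_eq_shadedBid hμ]
  exact (isWinProb_topWeight_cdf hμ P).shadedBid_lt_of_lt
    ((continuousOn_topWeight P).comp_continuous (continuous_cdf μ) hF)
    (strictMonoOn_topWeight hP (hF u) (hF v) huv)

lemma equilibriumSurplus_nonneg (v : ℝ) : 0 ≤ equilibriumSurplus (cdf μ) v P := by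
  rw [equilibriumSurplus, bidStoch_cdf_eq_shadedBid hμ]
  exact (isWinProb_topWeight_cdf hμ P).payoff_nonneg v

lemma topWeight_cdf_mul_sub_le_equilibriumSurplus (v r : ℝ) :
    topWeight P (cdf μ r) * (v - bidStoch (cdf μ) r P) ≤ equilibriumSurplus (cdf μ) v P := by
  rw [equilibriumSurplus, bidStoch_cdf_eq_shadedBid hμ, bidStoch_cdf_eq_shadedBid hμ]
  exact (isWinProb_topWeight_cdf hμ P).payoff_le v r

lemma topWeight_mul_sub_le_equilibriumSurplus (v x : ℝ) :
    topWeight P (μ.real {u | bidStoch (cdf μ) u P ≤ x}) * (v - x) ≤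
      equilibriumSurplus (cdf μ) v P := by
  set L : Set ℝ := {u | bidStoch (cdf μ) u P ≤ x}
  rcases L.eq_empty_or_nonempty with hL | hL
  · rw [hL, measureReal_empty, topWeight_zero, zero_mul]
    exact equilibriumSurplus_nonneg hμ P v
  have hlub : IsLUB (cdf μ '' L) (μ.real L) :=
    isLUB_cdf_image μ (fun a b hba ha => (monotone_bidStoch hμ P hba).trans ha) hL
  have hsub : cdf μ '' L ⊆ Set.Icc 0 1 := by
    rintro _ ⟨u, -, rfl⟩
    exact ⟨cdf_nonneg μ u, cdf_le_one μ u⟩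
  have hcont : ContinuousWithinAt (fun s => topWeight P s * (v - x)) (cdf μ '' L) (μ.real L) :=
    (((continuousOn_topWeight P).continuousWithinAt
      ⟨measureReal_nonneg, measureReal_le_one⟩).mono hsub).mul_const _
  have himitate : ∀ s ∈ cdf μ '' L, topWeight P s * (v - x) ≤ equilibriumSurplus (cdf μ) v P := by
    rintro _ ⟨r, hr, rfl⟩
    exact (mul_le_mul_of_nonneg_left (sub_le_sub_left hr v)
      (topWeight_nonneg P (cdf_nonneg μ r))).trans
      (topWeight_cdf_mul_sub_le_equilibriumSurplus hμ P v r)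
  exact hcont.closure_le (hlub.mem_closure (hL.image _)) continuousWithinAt_const himitate

end EquilibriumBids

/-! ### The first-price auction with a random number of bidders -/

section FirstPrice

variable {μ : Measure ℝ} [IsProbabilityMeasure μ] {b : ℝ → ℝ} {v x : ℝ}

lemma firstPriceUtility_nonneg (hxv : x ≤ v) {m : ℕ} (y : Fin m → ℝ) :
    0 ≤ firstPriceUtility v x y := by
  unfold firstPriceUtility
  split_ifs
  · exact div_nonneg (sub_nonneg.2 hxv) (Nat.cast_nonneg _)
  · exact le_rfl

lemma firstPriceUtility_le_max {m : ℕ} (y : Fin m → ℝ) :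
    firstPriceUtility v x y ≤ max (v - x) 0 := by
  unfold firstPriceUtility
  split_ifs
  · refine (div_le_div_of_nonneg_right (le_max_left _ 0) (Nat.cast_nonneg _)).trans ?_
    exact div_le_self (le_max_right _ _) (by simp)
  · exact le_max_right _ _

lemma norm_firstPriceUtility_le {m : ℕ} (y : Fin m → ℝ) :
    ‖firstPriceUtility v x y‖ ≤ |v - x| := by
  unfold firstPriceUtility
  split_ifs
  · rw [norm_div, Real.norm_eq_abs, Real.norm_natCast]
    exact div_le_self (abs_nonneg _) (by simp)
  · simp

lemma measurable_firstPriceUtility (hb : Measurable b) (m : ℕ) :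
    Measurable fun w : Fin m → ℝ => firstPriceUtility v x fun l => b (w l) := by
  have hbid (l : Fin m) : Measurable fun w : Fin m → ℝ => b (w l) :=
    hb.comp (measurable_pi_apply l)
  unfold firstPriceUtility
  simp only [Finset.card_filter, Nat.cast_add, Nat.cast_sum, Nat.cast_ite]
  refine Measurable.ite ?_ (.const_div (.const_add (Finset.measurable_sum _ fun l _ =>
    .ite ?_ measurable_const measurable_const) _) _) measurable_const
  · rw [Set.ofPred_forall]
    exact .iInter fun l => measurableSet_le (hbid l) measurable_const
  · exact measurableSet_eq_fun (hbid l) measurable_const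

lemma integrable_firstPriceUtility (hb : Measurable b) (m : ℕ) :
    Integrable (fun w : Fin m → ℝ => firstPriceUtility v x fun l => b (w l))
      (Measure.pi fun _ => μ) :=
  .of_bound (measurable_firstPriceUtility hb m).aestronglyMeasurable |v - x|
    (.of_forall fun _ => norm_firstPriceUtility_le _)

lemma hasSum_stochUtility (P : PMF ℕ) (b : ℝ → ℝ) (v x : ℝ) :
    HasSum (fun j => bidderWeight P j *
      ∫ w : Fin (j - 1) → ℝ, firstPriceUtility v x (fun l => b (w l)) ∂(Measure.pi fun _ => μ))
      (stochUtility μ P b v x) := by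
  have hsum : stochUtility μ P b v x = ∑' j, bidderWeight P j *
      ∫ w : Fin (j - 1) → ℝ, firstPriceUtility v x (fun l => b (w l)) ∂(Measure.pi fun _ => μ) :=
    tsum_congr fun _ => by
      unfold bidderWeight
      split_ifs <;> simp
  rw [hsum]
  refine (((summable_bidderWeight P).mul_right |v - x|).of_norm_bounded fun j => ?_).hasSum
  rw [norm_mul, Real.norm_of_nonneg (bidderWeight_nonneg P j)]
  refine mul_le_mul_of_nonneg_left ?_ (bidderWeight_nonneg P j)
  simpa using norm_integral_le_of_norm_le_const (μ := Measure.pi fun _ : Fin (j - 1) => μ)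
    (.of_forall fun w => norm_firstPriceUtility_le fun l => b (w l))

lemma hasSum_topWeight_mul (P : PMF ℕ) {L : Set ℝ} (hL : MeasurableSet L) (c : ℝ) :
    HasSum (fun j => bidderWeight P j *
      ∫ w : Fin (j - 1) → ℝ, (Set.univ.pi fun _ => L).indicator (fun _ => c) w
        ∂(Measure.pi fun _ => μ)) (topWeight P (μ.real L) * c) := by
  have hprob : μ.real L ∈ Set.Icc (0 : ℝ) 1 := ⟨measureReal_nonneg, measureReal_le_one⟩
  refine ((summable_bidderWeight_mul_pow P hprob).hasSum.mul_right c).congr_fun fun j => ?_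
  rw [integral_indicator_const c (.univ_pi fun _ => hL)]
  simp [measureReal_def, Measure.pi_pi, mul_assoc]

lemma stochUtility_le (P : PMF ℕ) (hb : Measurable b) (v x : ℝ) :
    stochUtility μ P b v x ≤ topWeight P (μ.real {u | b u ≤ x}) * max (v - x) 0 := by
  have hL : MeasurableSet {u | b u ≤ x} := measurableSet_le hb measurable_const
  refine hasSum_le (fun j => ?_) (hasSum_stochUtility P b v x) (hasSum_topWeight_mul P hL _)
  refine mul_le_mul_of_nonneg_left (integral_mono (integrable_firstPriceUtility hb _)
    ((integrable_const _).indicator (.univ_pi fun _ => hL)) fun w => ?_) (bidderWeight_nonneg P j)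
  by_cases hw : w ∈ Set.univ.pi fun _ => {u | b u ≤ x}
  · simpa only [Set.indicator_of_mem hw] using firstPriceUtility_le_max _
  · have hlose : ¬ ∀ l, b (w l) ≤ x := fun h => hw fun l _ => h l
    simp only [Set.indicator_of_notMem hw, firstPriceUtility, if_neg hlose, le_refl]

lemma topWeight_mul_sub_le_stochUtility (P : PMF ℕ) (hb : Measurable b) (hxv : x ≤ v) {L : Set ℝ}
    (hL : MeasurableSet L) (hbL : ∀ u ∈ L, b u < x) :
    topWeight P (μ.real L) * (v - x) ≤ stochUtility μ P b v x := by
  refine hasSum_le (fun j => ?_) (hasSum_topWeight_mul P hL _) (hasSum_stochUtility P b v x)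
  refine mul_le_mul_of_nonneg_left (integral_mono
    ((integrable_const _).indicator (.univ_pi fun _ => hL)) (integrable_firstPriceUtility hb _)
    fun w => ?_) (bidderWeight_nonneg P j)
  by_cases hw : w ∈ Set.univ.pi fun _ => L
  · have hlt (l : Fin (j - 1)) : b (w l) < x := hbL _ (hw l trivial)
    simp [Set.indicator_of_mem hw, firstPriceUtility, fun l => (hlt l).le, fun l => (hlt l).ne]
  · simpa only [Set.indicator_of_notMem hw] using firstPriceUtility_nonneg hxv _

theorem isSymmetricEquilibrium_bidStoch [NullSingletonClass μ] (hμ : μ (Set.Iio 0) = 0)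
    {P : PMF ℕ} (hP : ∃ j, 2 ≤ j ∧ P j ≠ 0) :
    IsSymmetricEquilibrium μ P fun v => bidStoch (cdf μ) v P := by
  intro v hv x
  have hb : Measurable fun u => bidStoch (cdf μ) u P := (monotone_bidStoch hμ P).measurable
  calc stochUtility μ P (fun u => bidStoch (cdf μ) u P) v x
      ≤ topWeight P (μ.real {u | bidStoch (cdf μ) u P ≤ x}) * max (v - x) 0 :=
        stochUtility_le P hb v x
    _ ≤ equilibriumSurplus (cdf μ) v P := by
        rcases max_choice (v - x) 0 with h | h <;> rw [h]
        · exact topWeight_mul_sub_le_equilibriumSurplus hμ P v x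
        · rw [mul_zero]
          exact equilibriumSurplus_nonneg hμ P v
    _ = topWeight P (μ.real {u | cdf μ u < cdf μ v}) * (v - bidStoch (cdf μ) v P) := by
        rw [measureReal_setOf_cdf_lt, equilibriumSurplus]
    _ ≤ stochUtility μ P (fun u => bidStoch (cdf μ) u P) v (bidStoch (cdf μ) v P) :=
        topWeight_mul_sub_le_stochUtility P hb (bidStoch_le_self hμ P hv)
          (measurableSet_lt (monotone_cdf μ).measurable measurable_const)
          fun _ hu => bidStoch_lt_of_cdf_lt hμ hP hu

end FirstPrice

/-! ### Clubs that split up bid more -/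

section Comparison

variable {μ : Measure ℝ} [IsProbabilityMeasure μ] {γ : PMF ℕ}

lemma topWeight_belief_measureReal (hγ : γ 0 = 0) {n k : ℕ} (hn : 2 ≤ n) (hk : 1 ≤ k) (L : Set ℝ) :
    topWeight (belief γ n k) (μ.real L) = (rivalWeight γ n k (μ L)).toReal :=
  topWeight_belief hγ hn hk prob_le_one

lemma bidStoch_belief_le_bidStoch_belief_split [NullSingletonClass μ] (hμ : μ (Set.Iio 0) = 0)
    (hγ : γ 0 = 0) {n k l : ℕ} (hn : 2 ≤ n) (hk : 1 ≤ k) (hl : 1 ≤ l) (v : ℝ) :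
    bidStoch (cdf μ) v (belief γ n k) ≤ bidStoch (cdf μ) v (belief γ (n + (k - 1)) l) := by
  have hn' : 2 ≤ n + (k - 1) := by omega
  rw [bidStoch_cdf_eq_shadedBid hμ, bidStoch_cdf_eq_shadedBid hμ]
  refine (isWinProb_topWeight_cdf hμ _).shadedBid_le_shadedBid (isWinProb_topWeight_cdf hμ _) ?_
    fun u hu => ?_ <;>
  simp only [cdf_eq_real, topWeight_belief_measureReal hγ hn hk,
    topWeight_belief_measureReal hγ hn' hl]
  · simp only [ne_eq, ENNReal.toReal_eq_zero_iff, rivalWeight_ne_top (prob_le_one (μ := μ)),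
      rivalWeight_eq_zero_iff hγ hn, rivalWeight_eq_zero_iff hγ hn', imp_self]
  · rw [← ENNReal.toReal_mul, ← ENNReal.toReal_mul]
    exact ENNReal.toReal_mono
      (ENNReal.mul_ne_top (rivalWeight_ne_top prob_le_one) (rivalWeight_ne_top prob_le_one))
      (rivalWeight_mul_le hγ (by omega) k l (measure_mono (Set.Iic_subset_Iic.2 hu.2)))

end Comparison

/-! ### Outcomes of the mechanism -/

section Outcomes

variable {κ : ℕ} {F : ℝ → ℝ} {γ : PMF ℕ} {C : Finset ℕ} {A : ℕ → Finset (Fin κ)}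
  {act : Agent κ → Action} {i : Agent κ} {v : ℝ}

open Classical in
lemma mem_bidders : i ∈ bidders C A act ↔
    i.1 ∈ C ∧ i.2 ∈ A i.1 ∧ if AllJoin A act i.1 then IsTop A act i else act i ≠ .abstain := by
  simp [bidders, Finset.mem_product]

lemma mem_winners : i ∈ winners F γ C A act ↔ i ∈ bidders C A act ∧
    ∀ j ∈ bidders C A act, mainBid F γ C A act j ≤ mainBid F γ C A act i := by
  simp [winners]

lemma existsUnique_isTop (act : Agent κ → Action) {c : ℕ} (hne : (A c).Nonempty) :
    ∃! a, a ∈ A c ∧ IsTop A act (c, a) := by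
  let key (a : Fin κ) : ℝ ×ₗ (Fin κ)ᵒᵈ := toLex ((act (c, a)).report, OrderDual.toDual a)
  have hkey : Function.Injective key := fun a b hab =>
    OrderDual.toDual_inj.1 (congrArg Prod.snd (toLex_inj.1 hab))
  have htop (a : Fin κ) : IsTop A act (c, a) ↔ ∀ a' ∈ A c, key a' ≤ key a := by
    simp only [IsTop, key, Prod.Lex.toLex_le_toLex, OrderDual.toDual_le_toDual]
  simp only [htop]
  obtain ⟨a, ha, hmax⟩ := (A c).exists_max_image key hne
  exact ⟨a, ⟨ha, hmax⟩, fun a' ⟨ha', hmax'⟩ => hkey ((hmax a' ha').antisymm (hmax' a ha))⟩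

lemma mem_bidders_of_not_allJoin {c : ℕ} (hc : c ∈ C) (hj : ¬ AllJoin A act c)
    (hact : ∀ a ∈ A c, act (c, a) ≠ .abstain) {a : Fin κ} :
    (c, a) ∈ bidders C A act ↔ a ∈ A c := by
  simp only [mem_bidders, hc, hj, if_false, true_and]
  exact ⟨fun h => h.1, fun h => ⟨h, hact a h⟩⟩

lemma announced_eq_sum :
    announced C A act = ∑ c ∈ C, ((bidders C A act).filter fun j => j.1 = c).card :=
  Finset.card_eq_sum_card_fiberwise fun _ hj => (mem_bidders.1 hj).1

lemma card_bidders_of_not_allJoin {c : ℕ} (hc : c ∈ C) (hj : ¬ AllJoin A act c)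
    (hact : ∀ a ∈ A c, act (c, a) ≠ .abstain) :
    ((bidders C A act).filter fun j => j.1 = c).card = (A c).card := by
  rw [← Finset.card_image_of_injective (A c) (Prod.mk_right_injective c)]
  congr 1
  ext ⟨c', a⟩
  simp only [Finset.mem_filter, Finset.mem_image, Prod.mk.injEq]
  constructor
  · rintro ⟨ha, rfl⟩
    exact ⟨a, (mem_bidders_of_not_allJoin hc hj hact).1 ha, rfl, rfl⟩
  · rintro ⟨a, ha, rfl, rfl⟩
    exact ⟨(mem_bidders_of_not_allJoin hc hj hact).2 ha, rfl⟩

lemma utility_of_notMem_winners (hi : i ∉ winners F γ C A act) :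
    utility F γ C A act v i = 0 := by simp [utility, hi]

lemma ofReal_utility_le_indicator {y : ℝ} {Ω : Type*} {E : Set Ω} {ω : Ω}
    (hE : i ∈ winners F γ C A act → ω ∈ E)
    (hy : mainBid F γ C A act i + clubPayment F γ C A act i = y) :
    ENNReal.ofReal (utility F γ C A act v i) ≤
      E.indicator (fun _ => ENNReal.ofReal (v - y)) ω := by
  by_cases hi : i ∈ winners F γ C A act
  · rw [Set.indicator_of_mem (hE hi), utility, if_pos hi, sub_sub, hy]
    have hcard : (1 : ℝ) ≤ (winners F γ C A act).card :=
      mod_cast Finset.card_pos.2 ⟨i, hi⟩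
    rw [ENNReal.ofReal_div_of_pos (by linarith)]
    exact ENNReal.div_le_of_le_mul (le_mul_of_one_le_right' (by simpa using hcard))
  · rw [utility_of_notMem_winners hi, ENNReal.ofReal_zero]
    exact zero_le

end Outcomes

/-! ### Clubs whose members accept and report truthfully -/

section FollowsClub

variable {κ : ℕ} {F : ℝ → ℝ} {γ : PMF ℕ} {C : Finset ℕ} {A : ℕ → Finset (Fin κ)}
  {act : Agent κ → Action} {u : Agent κ → ℝ} {i : Agent κ}

lemma clubStrategy_of_two_le {k : ℕ} (hk : 2 ≤ k) (v : ℝ) :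
    clubStrategy F γ v k = .join v := by simp [clubStrategy, hk]

lemma clubStrategy_of_lt_two {k : ℕ} (hk : k < 2) (v : ℝ) :
    clubStrategy F γ v k = .direct fun n => bidStoch F v (belief γ n 1) := by
  simp [clubStrategy, hk]

lemma clubStrategy_ne_abstain (k : ℕ) (v : ℝ) : clubStrategy F γ v k ≠ .abstain := by
  unfold clubStrategy
  split_ifs <;> simp

lemma clubStrategy_feasible (F : ℝ → ℝ) (γ : PMF ℕ) : (clubStrategy F γ).Feasible := by
  intro v k hjoin
  by_contra! hk
  rw [clubStrategy_of_lt_two hk] at hjoin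
  exact hjoin

/-- The agents of coordinator `c` act as `clubStrategy` prescribes for the valuations `u`, which may
differ from the true ones. A club member reporting a false valuation is covered by changing `u`. -/
def FollowsClub (F : ℝ → ℝ) (γ : PMF ℕ) (A : ℕ → Finset (Fin κ)) (act : Agent κ → Action)
    (u : Agent κ → ℝ) (c : ℕ) : Prop :=
  ∀ a ∈ A c, act (c, a) = clubStrategy F γ (u (c, a)) (A c).card

lemma mainBid_of_not_allJoin {c : ℕ} {a : Fin κ} {r : ℝ} (ha : a ∈ A c)
    (hact : act (c, a) = clubStrategy F γ r (A c).card) (hj : ¬ AllJoin A act c) :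
    mainBid F γ C A act (c, a) = bidStoch F r (belief γ (announced C A act) (A c).card) := by
  rcases le_or_gt 2 (A c).card with hk | hk
  · simp [mainBid, hact, clubStrategy_of_two_le hk, hj]
  · have hone : (A c).card = 1 := by have := Finset.card_pos.2 ⟨a, ha⟩; omega
    rw [mainBid, hact, clubStrategy_of_lt_two hk, hone]

namespace FollowsClub

variable {c : ℕ} (h : FollowsClub F γ A act u c)
include h

lemma allJoin (hk : 2 ≤ (A c).card) : AllJoin A act c := by
  intro a ha
  rw [h a ha, clubStrategy_of_two_le hk]
  trivial

lemma not_allJoin (hne : (A c).Nonempty) (hk : (A c).card < 2) : ¬ AllJoin A act c := by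
  obtain ⟨a, ha⟩ := hne
  intro hj
  have hjoin := hj a ha
  rw [h a ha, clubStrategy_of_lt_two hk] at hjoin
  exact hjoin

lemma report_eq (hk : 2 ≤ (A c).card) {a : Fin κ} (ha : a ∈ A c) :
    (act (c, a)).report = u (c, a) := by
  rw [h a ha, clubStrategy_of_two_le hk]
  rfl

lemma existsUnique_bidder (hc : c ∈ C) (hne : (A c).Nonempty) :
    ∃! a, (c, a) ∈ bidders C A act := by
  rcases le_or_gt 2 (A c).card with hk | hk
  · simpa [mem_bidders, hc, h.allJoin hk] using existsUnique_isTop act hne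
  · simp only [mem_bidders_of_not_allJoin hc (h.not_allJoin hne hk)
      fun a ha => by rw [h a ha]; exact clubStrategy_ne_abstain _ _]
    obtain ⟨a, ha⟩ := hne
    exact ⟨a, ha, fun a' ha' => Finset.card_le_one.1 (Nat.lt_succ_iff.1 hk) a' ha' a ha⟩

lemma card_bidders_eq_one (hc : c ∈ C) (hne : (A c).Nonempty) :
    ((bidders C A act).filter fun j => j.1 = c).card = 1 := by
  obtain ⟨a, ha, huniq⟩ := h.existsUnique_bidder hc hne
  refine Finset.card_eq_one.2 ⟨(c, a), Finset.eq_singleton_iff_unique_mem.2 ⟨by simp [ha], ?_⟩⟩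
  rintro ⟨c', a'⟩ hj
  obtain ⟨hbid, rfl⟩ : (c', a') ∈ bidders C A act ∧ c' = c := by simpa using hj
  rw [huniq a' hbid]

lemma le_of_mem_bidders {a a' : Fin κ} (ha : (c, a) ∈ bidders C A act) (ha' : a' ∈ A c) :
    u (c, a') ≤ u (c, a) := by
  have hac : a ∈ A c := (mem_bidders.1 ha).2.1
  rcases le_or_gt 2 (A c).card with hk | hk
  · have htop := (mem_bidders.1 ha).2.2
    rw [if_pos (h.allJoin hk)] at htop
    have hreport := htop a' ha'
    simp only [h.report_eq hk ha', h.report_eq hk hac] at hreport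
    exact hreport.elim le_of_lt fun heq => heq.1.le
  · rw [Finset.card_le_one.1 (Nat.lt_succ_iff.1 hk) a' ha' a hac]

lemma mem_bidders_of_lt (hc : c ∈ C) {a : Fin κ} (ha : a ∈ A c)
    (hlt : ∀ a' ∈ A c, a' ≠ a → u (c, a') < u (c, a)) : (c, a) ∈ bidders C A act := by
  obtain ⟨b, hb, -⟩ := h.existsUnique_bidder hc ⟨a, ha⟩
  by_cases hba : b = a
  · rwa [← hba]
  · exact absurd (h.le_of_mem_bidders hb ha) (hlt b (mem_bidders.1 hb).2.1 hba).not_ge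

lemma mainBid_eq {a : Fin κ} (ha : a ∈ A c) :
    mainBid F γ C A act (c, a) = bidStoch F (u (c, a)) (belief γ (announced C A act) 1) := by
  rcases le_or_gt 2 (A c).card with hk | hk
  · simp [mainBid, h a ha, clubStrategy_of_two_le hk, h.allJoin hk]
  · simp [mainBid, h a ha, clubStrategy_of_lt_two hk]

lemma mainBid_add_clubPayment {a : Fin κ} (ha : a ∈ A c) :
    mainBid F γ C A act (c, a) + clubPayment F γ C A act (c, a) =
      bidStoch F (u (c, a)) (belief γ (announced C A act) (A c).card) := by
  rw [h.mainBid_eq ha]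
  rcases le_or_gt 2 (A c).card with hk | hk
  · simp [clubPayment, h a ha, clubStrategy_of_two_le hk, h.allJoin hk]
  · have hone : (A c).card = 1 := by have := Finset.card_pos.2 ⟨a, ha⟩; omega
    rw [hone]
    simp [clubPayment, h a ha, clubStrategy_of_lt_two hk]

lemma bidStoch_le_of_mem_winners
    (hmono : Monotone fun v => bidStoch F v (belief γ (announced C A act) 1))
    (hi : i ∈ winners F γ C A act) (hc : c ∈ C) {a : Fin κ} (ha : a ∈ A c) :
    bidStoch F (u (c, a)) (belief γ (announced C A act) 1) ≤ mainBid F γ C A act i := by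
  obtain ⟨b, hb, -⟩ := h.existsUnique_bidder hc ⟨a, ha⟩
  calc bidStoch F (u (c, a)) (belief γ (announced C A act) 1)
      ≤ bidStoch F (u (c, b)) (belief γ (announced C A act) 1) :=
        hmono (h.le_of_mem_bidders hb ha)
    _ = mainBid F γ C A act (c, b) := (h.mainBid_eq (mem_bidders.1 hb).2.1).symm
    _ ≤ mainBid F γ C A act i := (mem_winners.1 hi).2 _ hb

end FollowsClub

lemma announced_eq_card (h : ∀ c ∈ C, FollowsClub F γ A act u c)
    (hne : ∀ c ∈ C, (A c).Nonempty) : announced C A act = C.card := by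
  rw [announced_eq_sum, Finset.sum_congr rfl fun c hc => (h c hc).card_bidders_eq_one hc (hne c hc),
    Finset.card_eq_sum_ones]

lemma announced_eq_card_add {c : ℕ} (hc : c ∈ C)
    (h : ∀ c' ∈ C, c' ≠ c → FollowsClub F γ A act u c') (hne : ∀ c ∈ C, (A c).Nonempty)
    (hj : ¬ AllJoin A act c) (hact : ∀ a ∈ A c, act (c, a) ≠ .abstain) :
    announced C A act = C.card + ((A c).card - 1) := by
  have hothers : ∑ c' ∈ C.erase c, ((bidders C A act).filter fun j => j.1 = c').card =
      C.card - 1 := by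
    rw [← Finset.card_erase_of_mem hc, Finset.card_eq_sum_ones]
    refine Finset.sum_congr rfl fun c' hc' => ?_
    obtain ⟨hcc', hc'⟩ := Finset.mem_erase.1 hc'
    exact (h c' hc' hcc').card_bidders_eq_one hc' (hne c' hc')
  rw [announced_eq_sum, ← Finset.sum_erase_add _ _ hc, hothers,
    card_bidders_of_not_allJoin hc hj hact]
  have hC := Finset.card_pos.2 ⟨c, hc⟩
  have hA := (hne c hc).card_pos
  omega

lemma winners_eq_singleton (h : ∀ c ∈ C, FollowsClub F γ A act u c)
    (hmono : Monotone fun v => bidStoch F v (belief γ (announced C A act) 1))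
    (hiC : i.1 ∈ C) (hi : i.2 ∈ A i.1)
    (hlt : ∀ c ∈ C, ∀ a ∈ A c, (c, a) ≠ i →
      bidStoch F (u (c, a)) (belief γ (announced C A act) 1) <
        bidStoch F (u i) (belief γ (announced C A act) 1)) :
    winners F γ C A act = {i} := by
  have hbid : i ∈ bidders C A act := (h i.1 hiC).mem_bidders_of_lt hiC hi fun a ha hai =>
    hmono.reflect_lt (hlt i.1 hiC a ha fun he => hai (congrArg Prod.snd he))
  have hloses : ∀ j ∈ bidders C A act, j ≠ i →
      mainBid F γ C A act j < mainBid F γ C A act i := by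
    rintro ⟨c, a⟩ hj hji
    obtain ⟨hc, ha, -⟩ := mem_bidders.1 hj
    rw [(h c hc).mainBid_eq ha]
    exact (hlt c hc a ha hji).trans_eq ((h i.1 hiC).mainBid_eq hi).symm
  refine Finset.eq_singleton_iff_unique_mem.2 ⟨mem_winners.2 ⟨hbid, fun j hj => ?_⟩, ?_⟩
  · rcases eq_or_ne j i with rfl | hji
    exacts [le_rfl, (hloses j hj hji).le]
  · intro j hj
    by_contra hji
    exact ((mem_winners.1 hj).2 i hbid).not_gt (hloses j (mem_winners.1 hj).1 hji)

end FollowsClub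

/-! ### Unilateral deviations -/

section Deviations

variable {κ : ℕ}

/-- The actions if agent `i` takes the action `d` and the others follow the club strategy, the
present agents being `A` and the valuations `w`. -/
def deviationProfile (F : ℝ → ℝ) (γ : PMF ℕ) (A : ℕ → Finset (Fin κ)) (w : Agent κ → ℝ)
    (i : Agent κ) (d : Action) : Agent κ → Action :=
  Function.update (fun j => clubStrategy F γ (w j) (A j.1).card) i d

/-- The event that the valuations of all the agents present with a coordinator in `C`, except `i`,
are in `L`. -/
def rivalsIn (C : Finset ℕ) (i : Agent κ) (L : Set ℝ) :
    Set ((ℕ → Finset (Fin κ)) × (Agent κ → ℝ)) :=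
  {p | ∀ c ∈ C, ∀ a ∈ p.1 c, (c, a) ≠ i → p.2 (c, a) ∈ L}

variable {F : ℝ → ℝ} {γ : PMF ℕ} {C : Finset ℕ} {A : ℕ → Finset (Fin κ)} {w : Agent κ → ℝ}
  {i : Agent κ} {d : Action} {v : ℝ}

lemma deviationProfile_self : deviationProfile F γ A w i d i = d := Function.update_self ..

lemma deviationProfile_of_ne {j : Agent κ} (hji : j ≠ i) :
    deviationProfile F γ A w i d j = clubStrategy F γ (w j) (A j.1).card :=
  Function.update_of_ne hji ..

lemma followsClub_deviationProfile_of_ne {c : ℕ} (hc : c ≠ i.1) :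
    FollowsClub F γ A (deviationProfile F γ A w i d) w c :=
  fun _ _ => deviationProfile_of_ne fun he => hc (congrArg Prod.fst he)

lemma followsClub_deviationProfile_clubStrategy (r : ℝ) (c : ℕ) :
    FollowsClub F γ A (deviationProfile F γ A w i (clubStrategy F γ r (A i.1).card))
      (Function.update w i r) c := by
  intro a _
  by_cases h : (c, a) = i
  · subst h
    simp [deviationProfile]
  · simp [deviationProfile, h]

lemma not_allJoin_deviationProfile (hd : ¬ d.IsJoin) (hi : i.2 ∈ A i.1) :
    ¬ AllJoin A (deviationProfile F γ A w i d) i.1 := fun hj =>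
  hd (by simpa only [Prod.mk.eta, deviationProfile_self] using hj i.2 hi)

lemma deviationProfile_ne_abstain (hd : d ≠ .abstain) (j : Agent κ) :
    deviationProfile F γ A w i d j ≠ .abstain := by
  rcases eq_or_ne j i with rfl | hji
  · rwa [deviationProfile_self]
  · rw [deviationProfile_of_ne hji]
    exact clubStrategy_ne_abstain _ _

lemma utility_abstain (hi : i.2 ∈ A i.1) :
    utility F γ C A (deviationProfile F γ A w i .abstain) v i = 0 := by
  refine utility_of_notMem_winners fun hwin => ?_
  have hregister := (mem_bidders.1 (mem_winners.1 hwin).1).2.2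
  rw [if_neg (not_allJoin_deviationProfile id hi)] at hregister
  exact hregister deviationProfile_self

lemma mainBid_add_clubPayment_clubStrategy (hi : i.2 ∈ A i.1) (hne : ∀ c ∈ C, (A c).Nonempty)
    (r : ℝ) :
    mainBid F γ C A (deviationProfile F γ A w i (clubStrategy F γ r (A i.1).card)) i +
        clubPayment F γ C A (deviationProfile F γ A w i (clubStrategy F γ r (A i.1).card)) i =
      bidStoch F r (belief γ C.card (A i.1).card) := by
  have hf := followsClub_deviationProfile_clubStrategy (F := F) (γ := γ) (A := A) (w := w)
    (i := i) r
  have hpay := (hf i.1).mainBid_add_clubPayment (C := C) hi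
  rwa [announced_eq_card (fun c _ => hf c) hne, Function.update_self] at hpay

variable {μ : Measure ℝ} [IsProbabilityMeasure μ] [NullSingletonClass μ]
  (hμ : μ (Set.Iio 0) = 0) (hi : i.2 ∈ A i.1) (hne : ∀ c ∈ C, (A c).Nonempty)
include hμ hi hne

lemma ofReal_utility_direct_le (hγ : γ 0 = 0) (hC : 2 ≤ C.card) (hiC : i.1 ∈ C)
    (bid : ℕ → ℝ) :
    ENNReal.ofReal
        (utility (cdf μ) γ C A (deviationProfile (cdf μ) γ A w i (.direct bid)) v i) ≤
      (rivalsIn C i {x | bidStoch (cdf μ) x (belief γ C.card (A i.1).card) ≤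
          bid (C.card + ((A i.1).card - 1))}).indicator
        (fun _ => ENNReal.ofReal (v - bid (C.card + ((A i.1).card - 1)))) (A, w) := by
  set k := (A i.1).card
  set act := deviationProfile (cdf μ) γ A w i (.direct bid)
  have hk : 1 ≤ k := Finset.card_pos.2 ⟨i.2, hi⟩
  have hself : act i = .direct bid := deviationProfile_self
  have hother : ∀ c, c ≠ i.1 → FollowsClub (cdf μ) γ A act w c := fun c =>
    followsClub_deviationProfile_of_ne
  have hj : ¬ AllJoin A act i.1 := not_allJoin_deviationProfile id hi
  have hact (a : Fin κ) (_ : a ∈ A i.1) : act (i.1, a) ≠ .abstain :=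
    deviationProfile_ne_abstain (by simp) _
  have hn : announced C A act = C.card + (k - 1) :=
    announced_eq_card_add hiC (fun c _ => hother c) hne hj hact
  have hbid : mainBid (cdf μ) γ C A act i = bid (C.card + (k - 1)) := by
    simp [mainBid, hself, hn]
  refine ofReal_utility_le_indicator (fun hwin c hc a ha hai => ?_)
    (by simp [clubPayment, hself, hbid])
  rw [Set.mem_ofPred_eq, ← hbid]
  rcases eq_or_ne c i.1 with rfl | hci
  · calc bidStoch (cdf μ) (w (i.1, a)) (belief γ C.card k)
        ≤ bidStoch (cdf μ) (w (i.1, a)) (belief γ (C.card + (k - 1)) k) :=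
          bidStoch_belief_le_bidStoch_belief_split hμ hγ hC hk hk _
      _ = mainBid (cdf μ) γ C A act (i.1, a) := by
          rw [mainBid_of_not_allJoin ha (deviationProfile_of_ne hai) hj, hn]
      _ ≤ mainBid (cdf μ) γ C A act i :=
          (mem_winners.1 hwin).2 _ ((mem_bidders_of_not_allJoin hiC hj hact).2 ha)
  · calc bidStoch (cdf μ) (w (c, a)) (belief γ C.card k)
        ≤ bidStoch (cdf μ) (w (c, a)) (belief γ (C.card + (k - 1)) 1) :=
          bidStoch_belief_le_bidStoch_belief_split hμ hγ hC hk le_rfl _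
      _ ≤ mainBid (cdf μ) γ C A act i := by
          rw [← hn]
          exact (hother c hci).bidStoch_le_of_mem_winners (monotone_bidStoch hμ _) hwin hc ha

lemma ofReal_utility_clubStrategy_le (hγ : γ 0 = 0) (hC : 2 ≤ C.card) (r : ℝ) :
    ENNReal.ofReal (utility (cdf μ) γ C A
        (deviationProfile (cdf μ) γ A w i (clubStrategy (cdf μ) γ r (A i.1).card)) v i) ≤
      (rivalsIn C i {x | cdf μ x ≤ cdf μ r}).indicator
        (fun _ => ENNReal.ofReal (v - bidStoch (cdf μ) r (belief γ C.card (A i.1).card)))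
        (A, w) := by
  refine ofReal_utility_le_indicator (fun hwin c hc a ha hai => ?_)
    (mainBid_add_clubPayment_clubStrategy hi hne r)
  refine not_lt.1 fun (hlt : cdf μ r < cdf μ (w (c, a))) => ?_
  have hf := followsClub_deviationProfile_clubStrategy (F := cdf μ) (γ := γ) (A := A) (w := w)
    (i := i) r
  have hle := (hf c).bidStoch_le_of_mem_winners (monotone_bidStoch hμ _) hwin hc ha
  rw [show mainBid _ _ _ _ _ i = _ from (hf i.1).mainBid_eq hi, Prod.mk.eta,
    Function.update_of_ne hai, Function.update_self, announced_eq_card (fun c _ => hf c) hne] at hle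
  exact hle.not_gt (bidStoch_lt_of_cdf_lt hμ (exists_two_le_belief_apply_ne_zero hγ hC le_rfl) hlt)

lemma utility_clubStrategy_nonneg (hv : 0 ≤ v) :
    0 ≤ utility (cdf μ) γ C A
      (deviationProfile (cdf μ) γ A w i (clubStrategy (cdf μ) γ v (A i.1).card)) v i := by
  unfold utility
  split_ifs
  · rw [sub_sub, mainBid_add_clubPayment_clubStrategy hi hne]
    exact div_nonneg (sub_nonneg.2 (bidStoch_le_self hμ _ hv)) (Nat.cast_nonneg _)
  · exact le_rfl

lemma indicator_le_ofReal_utility_clubStrategy (hγ : γ 0 = 0) (hC : 2 ≤ C.card)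
    (hiC : i.1 ∈ C) :
    (rivalsIn C i {x | cdf μ x < cdf μ v}).indicator
        (fun _ => ENNReal.ofReal (v - bidStoch (cdf μ) v (belief γ C.card (A i.1).card)))
        (A, w) ≤
      ENNReal.ofReal (utility (cdf μ) γ C A
        (deviationProfile (cdf μ) γ A w i (clubStrategy (cdf μ) γ v (A i.1).card)) v i) := by
  refine Set.indicator_apply_le' (fun hrivals => ENNReal.ofReal_le_ofReal ?_) fun _ => zero_le
  have hf := followsClub_deviationProfile_clubStrategy (F := cdf μ) (γ := γ) (A := A) (w := w)
    (i := i) v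
  have hwin := winners_eq_singleton (fun c _ => hf c) (monotone_bidStoch hμ _) hiC hi
    fun c hc a ha hai => by
      rw [Function.update_of_ne hai, Function.update_self, announced_eq_card (fun c _ => hf c) hne]
      exact bidStoch_lt_of_cdf_lt hμ (exists_two_le_belief_apply_ne_zero hγ hC le_rfl)
        (hrivals c hc a ha hai)
  rw [utility, hwin, if_pos (Finset.mem_singleton_self i), sub_sub,
    mainBid_add_clubPayment_clubStrategy hi hne, Finset.card_singleton, Nat.cast_one, div_one]

end Deviations

/-! ### Probabilities of outcomes -/

section Probabilities

lemma map_apply_ne_zero {α β : Type*} (p : PMF α) (f : α → β) {a : α} (ha : p a ≠ 0) :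
    p.map f (f a) ≠ 0 :=
  (PMF.mem_support_iff _ _).1 ((PMF.mem_support_map_iff _ _ _).2 ⟨a, ha, rfl⟩)

lemma two_le_card_of_apply_ne_zero {α : Type*} {p : PMF (Finset α)} (hp : (p.map Finset.card) 1 = 0)
    {C : Finset α} (hC : p C ≠ 0) {c : α} (hc : c ∈ C) : 2 ≤ C.card := by
  have hpos := Finset.card_pos.2 ⟨c, hc⟩
  have hne : C.card ≠ 1 := fun hone => map_apply_ne_zero p Finset.card hC (by rw [hone, hp])
  omega

lemma lintegral_toMeasure_prod {α β : Type*} [Countable α] [MeasurableSpace α]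
    [DiscreteMeasurableSpace α] [MeasurableSpace β] (p : PMF α) (ν : Measure β) [SFinite ν]
    (f : α × β → ℝ≥0∞) :
    ∫⁻ z, f z ∂p.toMeasure.prod ν = ∑' a, p a * ∫⁻ y, f (a, y) ∂ν := by
  have hp : p.toMeasure = Measure.sum fun a => p a • Measure.dirac a := by
    rw [← Measure.sum_smul_dirac p.toMeasure]
    simp_rw [p.toMeasure_apply_singleton _ (measurableSet_singleton _)]
  rw [hp, Measure.prod_sum_left, lintegral_sum_measure]
  refine tsum_congr fun a => ?_
  rw [Measure.prod_smul_left, lintegral_smul_measure, Measure.dirac_prod,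
    (measurableEmbedding_prodMk_left a).lintegral_map, smul_eq_mul]

variable {κ : ℕ} (βA : PMF (Finset (Fin κ))) (μ : Measure ℝ)

/-- The joint law of the sets of agents and of the valuations. -/
def agentsLaw : Measure ((ℕ → Finset (Fin κ)) × (Agent κ → ℝ)) :=
  (Measure.infinitePi fun _ : ℕ => βA.toMeasure).prod (Measure.infinitePi fun _ : Agent κ => μ)

lemma ae_agentsLaw_nonempty (hA0 : (βA.map Finset.card) 0 = 0) :
    ∀ᵐ p ∂agentsLaw βA μ, ∀ c, (p.1 c).Nonempty := by
  have hβA : ∀ᵐ B ∂βA.toMeasure, B.Nonempty := by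
    refine ae_iff_of_countable.2 fun B hB => ?_
    rw [PMF.toMeasure_apply_singleton _ _ (measurableSet_singleton B)] at hB
    refine Finset.nonempty_iff_ne_empty.2 fun hempty => map_apply_ne_zero βA Finset.card hB ?_
    rw [hempty, Finset.card_empty, hA0]
  have hsets : ∀ᵐ A ∂(Measure.infinitePi fun _ : ℕ => βA.toMeasure), ∀ c, (A c).Nonempty :=
    ae_all_iff.2 fun c => (measurePreserving_eval_infinitePi
      (fun _ : ℕ => βA.toMeasure) c).quasiMeasurePreserving.ae hβA
  exact Measure.quasiMeasurePreserving_fst.ae hsets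

variable [IsProbabilityMeasure μ]

instance : IsProbabilityMeasure (agentsLaw βA μ) := by
  unfold agentsLaw
  infer_instance

/-- The event that agent `i` is selected by his coordinator together with `k - 1` other agents. -/
def presentIn (i : Agent κ) (k : ℕ) : Set ((ℕ → Finset (Fin κ)) × (Agent κ → ℝ)) :=
  {p | i.2 ∈ p.1 i.1 ∧ (p.1 i.1).card = k}

variable {i : Agent κ} {k : ℕ}

lemma presentIn_zero : presentIn i 0 = ∅ := by
  refine Set.eq_empty_of_forall_notMem fun p ⟨hi, hcard⟩ => ?_
  simp [Finset.card_eq_zero.1 hcard] at hi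

variable (i k) in
lemma measurableSet_presentIn : MeasurableSet (presentIn i k) := by
  have heval : Measurable fun p : (ℕ → Finset (Fin κ)) × (Agent κ → ℝ) => p.1 i.1 := by fun_prop
  exact heval (MeasurableSet.of_discrete (s := {B : Finset (Fin κ) | i.2 ∈ B ∧ B.card = k}))

variable (i) in
lemma measurableSet_rivalsIn (C : Finset ℕ) {L : Set ℝ} (hL : MeasurableSet L) :
    MeasurableSet (rivalsIn C i L) := by
  have hmem (c : ℕ) (a : Fin κ) :
      Measurable fun p : (ℕ → Finset (Fin κ)) × (Agent κ → ℝ) => a ∈ p.1 c := by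
    have heval : Measurable fun p : (ℕ → Finset (Fin κ)) × (Agent κ → ℝ) => p.1 c := by fun_prop
    exact measurableSet_setOfPred.1
      (heval (MeasurableSet.of_discrete (s := {B : Finset (Fin κ) | a ∈ B})))
  have hval (j : Agent κ) :
      Measurable fun p : (ℕ → Finset (Fin κ)) × (Agent κ → ℝ) => p.2 j ∈ L := by
    have heval : Measurable fun p : (ℕ → Finset (Fin κ)) × (Agent κ → ℝ) => p.2 j := by fun_prop
    exact measurableSet_setOfPred.1 (heval hL)
  exact measurableSet_setOfPred.2 (.forall fun c => measurable_const.imp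
    (.forall fun a => (hmem c a).imp (measurable_const.imp (hval (c, a)))))

lemma infinitePi_setOf_forall_mem (C : Finset ℕ) (A : ℕ → Finset (Fin κ)) {U : Agent κ → Set ℝ}
    (hU : ∀ j, MeasurableSet (U j)) :
    (Measure.infinitePi fun _ : Agent κ => μ) {w | ∀ c ∈ C, ∀ a ∈ A c, w (c, a) ∈ U (c, a)} =
      ∏ c ∈ C, ∏ a ∈ A c, μ (U (c, a)) := by
  have hbox : {w : Agent κ → ℝ | ∀ c ∈ C, ∀ a ∈ A c, w (c, a) ∈ U (c, a)} =
      Set.pi ((C ×ˢ Finset.univ).filter fun j => j.2 ∈ A j.1) U := by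
    ext w
    simp only [Set.mem_pi, Finset.coe_filter, Finset.mem_product, Finset.mem_univ, and_true,
      Prod.forall, Set.mem_ofPred_eq, and_imp]
    exact forall_congr' fun c => forall_comm
  rw [hbox, Measure.infinitePi_pi _ fun j _ => hU j, Finset.prod_filter, Finset.prod_product]
  simp only [Finset.prod_ite_mem, Finset.univ_inter]

lemma lintegral_infinitePi_prod (C : Finset ℕ) (g : ℕ → Finset (Fin κ) → ℝ≥0∞) :
    ∫⁻ A, ∏ c ∈ C, g c (A c) ∂(Measure.infinitePi fun _ : ℕ => βA.toMeasure) =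
      ∏ c ∈ C, ∑' B, βA B * g c B := by
  have hindep : iIndepFun (fun (c : ℕ) (A : ℕ → Finset (Fin κ)) => g c (A c))
      (Measure.infinitePi fun _ : ℕ => βA.toMeasure) :=
    iIndepFun_infinitePi (X := fun c B => g c B) fun c => Measurable.of_discrete
  rw [lintegral_prod_eq_prod_lintegral_of_indepFun C _ hindep
    fun c => Measurable.of_discrete.comp (measurable_pi_apply c)]
  refine Finset.prod_congr rfl fun c _ => ?_
  rw [(measurePreserving_eval_infinitePi (fun _ : ℕ => βA.toMeasure) c).lintegral_comp
    (f := g c) Measurable.of_discrete, lintegral_countable']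
  exact tsum_congr fun B => by
    rw [PMF.toMeasure_apply_singleton _ _ (measurableSet_singleton B), mul_comm]

lemma agentsLaw_setOf_forall_mem (C : Finset ℕ) (𝓑 : ℕ → Set (Finset (Fin κ)))
    {U : Agent κ → Set ℝ} (hU : ∀ j, MeasurableSet (U j))
    {E : Set ((ℕ → Finset (Fin κ)) × (Agent κ → ℝ))} (hE : MeasurableSet E)
    (hE_iff : ∀ p, p ∈ E ↔ ∀ c ∈ C, p.1 c ∈ 𝓑 c ∧ ∀ a ∈ p.1 c, p.2 (c, a) ∈ U (c, a)) :
    agentsLaw βA μ E =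
      ∏ c ∈ C, ∑' B, βA B * (𝓑 c).indicator (fun B => ∏ a ∈ B, μ (U (c, a))) B := by
  rw [agentsLaw, Measure.prod_apply hE, ← lintegral_infinitePi_prod]
  refine lintegral_congr fun A => ?_
  by_cases hA : ∀ c ∈ C, A c ∈ 𝓑 c
  · rw [Finset.prod_congr rfl fun c hc => Set.indicator_of_mem (hA c hc) _,
      ← infinitePi_setOf_forall_mem μ C A hU]
    congr 1
    ext w
    exact (hE_iff (A, w)).trans (forall₂_congr fun c hc => and_iff_right (hA c hc))
  · have hempty : Prod.mk A ⁻¹' E = ∅ :=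
      Set.eq_empty_of_forall_notMem fun w hw => hA fun c hc => ((hE_iff (A, w)).1 hw c hc).1
    push Not at hA
    obtain ⟨c, hc, hcA⟩ := hA
    rw [hempty, measure_empty, Finset.prod_eq_zero hc (Set.indicator_of_notMem hcA _)]

lemma mem_presentIn_inter_rivalsIn {C : Finset ℕ} (hiC : i.1 ∈ C) {L : Set ℝ}
    {p : (ℕ → Finset (Fin κ)) × (Agent κ → ℝ)} :
    p ∈ presentIn i k ∩ rivalsIn C i L ↔ ∀ c ∈ C,
      p.1 c ∈ {B : Finset (Fin κ) | c = i.1 → i.2 ∈ B ∧ B.card = k} ∧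
        ∀ a ∈ p.1 c, p.2 (c, a) ∈ {x | (c, a) ≠ i → x ∈ L} := by
  refine ⟨fun ⟨hpresent, hrivals⟩ c hc => ⟨?_, hrivals c hc⟩, fun h =>
    ⟨(h i.1 hiC).1 rfl, fun c hc => (h c hc).2⟩⟩
  rintro rfl
  exact hpresent

lemma prod_measure_setOf_ne_imp (L : Set ℝ) {B : Finset (Fin κ)} (hB : i.2 ∈ B) :
    ∏ a ∈ B, μ {x | (i.1, a) ≠ i → x ∈ L} = μ L ^ (B.card - 1) := by
  have hself : μ {x | (i.1, i.2) ≠ i → x ∈ L} = 1 := by simp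
  have hmate : ∀ a ∈ B.erase i.2, μ {x | (i.1, a) ≠ i → x ∈ L} = μ L := fun a ha => by
    simp [Prod.ext_iff, Finset.ne_of_mem_erase ha]
  rw [← Finset.mul_prod_erase B _ hB, hself, one_mul, Finset.prod_congr rfl hmate,
    Finset.prod_const, Finset.card_erase_of_mem hB]

lemma agentsLaw_presentIn_inter_rivalsIn {C : Finset ℕ} (hiC : i.1 ∈ C) {L : Set ℝ}
    (hL : MeasurableSet L) :
    agentsLaw βA μ (presentIn i k ∩ rivalsIn C i L) =
      agentsLaw βA μ (presentIn i k) * rivalWeight (βA.map Finset.card) C.card k (μ L) := by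
  have hfactor {L : Set ℝ} (hL : MeasurableSet L) :
      agentsLaw βA μ (presentIn i k ∩ rivalsIn C i L) =
        (∑' B, βA B * {B : Finset (Fin κ) | i.2 ∈ B ∧ B.card = k}.indicator 1 B) *
          rivalWeight (βA.map Finset.card) C.card k (μ L) := by
    rw [agentsLaw_setOf_forall_mem βA μ C (fun c => {B | c = i.1 → i.2 ∈ B ∧ B.card = k})
      (U := fun j => {x | j ≠ i → x ∈ L}) (fun j => (MeasurableSet.const _).imp hL)
      ((measurableSet_presentIn i k).inter (measurableSet_rivalsIn i C hL))
      fun p => mem_presentIn_inter_rivalsIn hiC, ← Finset.mul_prod_erase C _ hiC, rivalWeight,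
      ← mul_assoc]
    congr 1
    · rw [← ENNReal.tsum_mul_right]
      refine tsum_congr fun B => ?_
      by_cases hB : i.2 ∈ B ∧ B.card = k
      · simp [hB, prod_measure_setOf_ne_imp μ L hB.1]
      · simp [hB]
    · have hclub : ∀ c ∈ C.erase i.1,
          (∑' B, βA B * {B : Finset (Fin κ) | c = i.1 → i.2 ∈ B ∧ B.card = k}.indicator
            (fun B => ∏ a ∈ B, μ {x | (c, a) ≠ i → x ∈ L}) B) =
          pgf (βA.map Finset.card) (μ L) := fun c hc => by
        simp [pgf_map_card, Prod.ext_iff, Finset.ne_of_mem_erase hc]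
      rw [Finset.prod_congr rfl hclub, Finset.prod_const, Finset.card_erase_of_mem hiC]
  have huniv : rivalsIn C i Set.univ = Set.univ := Set.eq_univ_of_forall fun p c _ a _ _ => trivial
  rw [hfactor hL, ← Set.inter_univ (presentIn i k), ← huniv, hfactor .univ, measure_univ]
  simp [rivalWeight, pgf_one]

lemma setLIntegral_indicator_rivalsIn (hA0 : (βA.map Finset.card) 0 = 0) {C : Finset ℕ}
    (hC : 2 ≤ C.card) (hiC : i.1 ∈ C) (hk : 1 ≤ k) {L : Set ℝ} (hL : MeasurableSet L) (y : ℝ) :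
    ∫⁻ p in presentIn i k, (rivalsIn C i L).indicator (fun _ => ENNReal.ofReal y) p
        ∂agentsLaw βA μ =
      agentsLaw βA μ (presentIn i k) *
        ENNReal.ofReal (topWeight (belief (βA.map Finset.card) C.card k) (μ.real L) * y) := by
  have hrivals := measurableSet_rivalsIn i C hL
  rw [lintegral_indicator_const hrivals, Measure.restrict_apply hrivals, Set.inter_comm,
    agentsLaw_presentIn_inter_rivalsIn βA μ hiC hL, topWeight_belief_measureReal hA0 hC hk,
    ENNReal.ofReal_mul ENNReal.toReal_nonneg,
    ENNReal.ofReal_toReal (rivalWeight_ne_top prob_le_one), mul_comm, mul_assoc]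

lemma setLIntegral_presentIn_le (hA0 : (βA.map Finset.card) 0 = 0) {C : Finset ℕ}
    (hC : 2 ≤ C.card) (hiC : i.1 ∈ C) (hk : 1 ≤ k) {L : Set ℝ} (hL : MeasurableSet L) {y : ℝ}
    {f : (ℕ → Finset (Fin κ)) × (Agent κ → ℝ) → ℝ≥0∞}
    (hf : ∀ p ∈ presentIn i k, (∀ c, (p.1 c).Nonempty) →
      f p ≤ (rivalsIn C i L).indicator (fun _ => ENNReal.ofReal y) p) :
    ∫⁻ p in presentIn i k, f p ∂agentsLaw βA μ ≤
      agentsLaw βA μ (presentIn i k) *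
        ENNReal.ofReal (topWeight (belief (βA.map Finset.card) C.card k) (μ.real L) * y) := by
  rw [← setLIntegral_indicator_rivalsIn βA μ hA0 hC hiC hk hL]
  refine setLIntegral_mono_ae' (measurableSet_presentIn i k) ?_
  filter_upwards [ae_agentsLaw_nonempty βA μ hA0] with p hne hp using hf p hp hne

variable (βC : PMF (Finset ℕ))

variable (i k) in
lemma measurableSet_selected : MeasurableSet (selected i k : Set (State κ)) := by
  have hmem : MeasurableSet {ω : State κ | i.1 ∈ ω.1} :=
    measurable_fst (MeasurableSet.of_discrete (s := {C : Finset ℕ | i.1 ∈ C}))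
  exact hmem.inter (measurable_snd (measurableSet_presentIn i k))

variable (i k) in
lemma setLIntegral_selected (f : State κ → ℝ≥0∞) :
    ∫⁻ ω in selected i k, f ω ∂prior βC βA μ =
      ∑' C, βC C * {C : Finset ℕ | i.1 ∈ C}.indicator
        (fun C => ∫⁻ p in presentIn i k, f (C, p) ∂agentsLaw βA μ) C := by
  rw [← lintegral_indicator (measurableSet_selected i k)]
  refine (lintegral_toMeasure_prod βC (agentsLaw βA μ) _).trans (tsum_congr fun C => ?_)
  congr 1
  by_cases hC : i.1 ∈ C
  · rw [Set.indicator_of_mem (by exact hC), ← lintegral_indicator (measurableSet_presentIn i k)]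
    refine lintegral_congr fun p => ?_
    simp [Set.indicator_apply, selected, presentIn, hC]
  · rw [Set.indicator_of_notMem (by exact hC), ← lintegral_zero (μ := agentsLaw βA μ)]
    exact lintegral_congr fun p => Set.indicator_of_notMem (fun h => hC h.1) _

variable {βA μ βC} in
lemma lintegral_cond_selected_mono {f g : State κ → ℝ≥0∞}
    (hfg : ∀ C, βC C ≠ 0 → i.1 ∈ C →
      ∫⁻ p in presentIn i k, f (C, p) ∂agentsLaw βA μ ≤
        ∫⁻ p in presentIn i k, g (C, p) ∂agentsLaw βA μ) :
    ∫⁻ ω, f ω ∂(prior βC βA μ)[|selected i k] ≤ ∫⁻ ω, g ω ∂(prior βC βA μ)[|selected i k] := by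
  simp only [ProbabilityTheory.cond, lintegral_smul_measure, setLIntegral_selected]
  refine mul_le_mul_right (ENNReal.tsum_le_tsum fun C => ?_) _
  rcases eq_or_ne (βC C) 0 with hC | hC
  · simp [hC]
  · refine mul_le_mul_right ?_ _
    by_cases hiC : i.1 ∈ C
    · simpa [hiC] using hfg C hC hiC
    · simp [hiC]

end Probabilities

/-! ### The equilibrium of the bidding-club game -/

section Equilibrium

variable {κ : ℕ} {βC : PMF (Finset ℕ)} {βA : PMF (Finset (Fin κ))} {μ : Measure ℝ}
  [IsProbabilityMeasure μ] [NullSingletonClass μ] (hμ : μ (Set.Iio 0) = 0)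
  (hA0 : (βA.map Finset.card) 0 = 0) {C : Finset ℕ} {i : Agent κ} {k : ℕ}
include hμ hA0

lemma setLIntegral_ofReal_utility_le (hC : 2 ≤ C.card) (hiC : i.1 ∈ C) (hk : 1 ≤ k) {d : Action}
    (hd : d.IsJoin → 2 ≤ k) (v : ℝ) :
    ∫⁻ p in presentIn i k, ENNReal.ofReal (utility (cdf μ) (βA.map Finset.card) C p.1
        (deviationProfile (cdf μ) (βA.map Finset.card) p.1 p.2 i d) v i) ∂agentsLaw βA μ ≤
      agentsLaw βA μ (presentIn i k) * ENNReal.ofReal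
        (equilibriumSurplus (cdf μ) v (belief (βA.map Finset.card) C.card k)) := by
  cases d with
  | abstain =>
    refine (setLIntegral_mono' (g := 0) (measurableSet_presentIn i k)
      fun p hp => ?_).trans (by simp)
    simp [utility_abstain hp.1]
  | direct bid =>
    let b := bid (C.card + (k - 1))
    refine (setLIntegral_presentIn_le βA μ hA0 hC hiC hk (y := v - b)
        (measurableSet_le (monotone_bidStoch hμ _).measurable (measurable_const (a := b))) ?_).trans
      (mul_le_mul_right
        (ENNReal.ofReal_le_ofReal (topWeight_mul_sub_le_equilibriumSurplus hμ _ v b)) _)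
    rintro p ⟨hi, rfl⟩ hne
    exact ofReal_utility_direct_le hμ hi (fun c _ => hne c) hA0 hC hiC bid
  | join r =>
    refine (setLIntegral_presentIn_le βA μ hA0 hC hiC hk
        (y := v - bidStoch (cdf μ) r (belief (βA.map Finset.card) C.card k))
        (measurableSet_le (monotone_cdf μ).measurable (measurable_const (a := cdf μ r))) ?_).trans
      (mul_le_mul_right (ENNReal.ofReal_le_ofReal ?_) _)
    · rw [← clubStrategy_of_two_le (F := cdf μ) (γ := βA.map Finset.card) (hd trivial) r]
      rintro p ⟨hi, rfl⟩ hne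
      exact ofReal_utility_clubStrategy_le hμ hi (fun c _ => hne c) hA0 hC r
    · rw [measureReal_setOf_cdf_le]
      exact topWeight_cdf_mul_sub_le_equilibriumSurplus hμ _ v r

lemma le_setLIntegral_ofReal_utility_clubStrategy (hC : 2 ≤ C.card) (hiC : i.1 ∈ C) (hk : 1 ≤ k)
    (v : ℝ) :
    agentsLaw βA μ (presentIn i k) * ENNReal.ofReal
        (equilibriumSurplus (cdf μ) v (belief (βA.map Finset.card) C.card k)) ≤
      ∫⁻ p in presentIn i k, ENNReal.ofReal (utility (cdf μ) (βA.map Finset.card) C p.1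
        (deviationProfile (cdf μ) (βA.map Finset.card) p.1 p.2 i
          (clubStrategy (cdf μ) (βA.map Finset.card) v k)) v i) ∂agentsLaw βA μ := by
  rw [equilibriumSurplus, ← measureReal_setOf_cdf_lt, ← setLIntegral_indicator_rivalsIn βA μ hA0 hC
    hiC hk (measurableSet_lt (monotone_cdf μ).measurable measurable_const)]
  refine setLIntegral_mono_ae' (measurableSet_presentIn i k) ?_
  filter_upwards [ae_agentsLaw_nonempty βA μ hA0] with p hne
  rintro ⟨hi, rfl⟩
  exact indicator_le_ofReal_utility_clubStrategy hμ hi (fun c _ => hne c) hA0 hC hiC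

lemma setLIntegral_ofReal_neg_utility_clubStrategy {v : ℝ} (hv : 0 ≤ v) :
    ∫⁻ p in presentIn i k, ENNReal.ofReal (-utility (cdf μ) (βA.map Finset.card) C p.1
        (deviationProfile (cdf μ) (βA.map Finset.card) p.1 p.2 i
          (clubStrategy (cdf μ) (βA.map Finset.card) v k)) v i) ∂agentsLaw βA μ = 0 := by
  refine nonpos_iff_eq_zero.1 ((setLIntegral_mono_ae' (g := 0)
    (measurableSet_presentIn i k) ?_).trans (by simp))
  filter_upwards [ae_agentsLaw_nonempty βA μ hA0] with p hne
  rintro ⟨hi, rfl⟩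
  exact (ENNReal.ofReal_of_nonpos (neg_nonpos.2
    (utility_clubStrategy_nonneg hμ hi (fun c _ => hne c) hv))).le

theorem isBayesNash_clubStrategy (hC1 : (βC.map Finset.card) 1 = 0) :
    IsBayesNash βC βA μ fun _ => clubStrategy (cdf μ) (βA.map Finset.card) := by
  refine ⟨fun _ => clubStrategy_feasible _ _, fun i v k hv s hs =>
    EReal.sub_le_sub (mod_cast lintegral_cond_selected_mono fun C hC hiC => ?_)
      (mod_cast lintegral_cond_selected_mono fun _ _ _ => ?_)⟩
  · rcases Nat.eq_zero_or_pos k with rfl | hk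
    · simp [presentIn_zero]
    · have hcard := two_le_card_of_apply_ne_zero hC1 hC hiC
      exact (setLIntegral_ofReal_utility_le hμ hA0 hcard hiC hk (hs v k) v).trans
        (le_setLIntegral_ofReal_utility_clubStrategy hμ hA0 hcard hiC hk v)
  · exact (setLIntegral_ofReal_neg_utility_clubStrategy hμ hA0 hv).trans_le zero_le

end Equilibrium

end BiddingClubs

end

theorem mainTheorem1 {κ : ℕ} (βC : PMF (Finset ℕ)) (βA : PMF (Finset (Fin κ)))
    (hC0 : (βC.map Finset.card) 0 = 0) (hC1 : (βC.map Finset.card) 1 = 0)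
    (hA0 : (βA.map Finset.card) 0 = 0)
    (μ : MeasureTheory.Measure ℝ) [MeasureTheory.IsProbabilityMeasure μ]
    [MeasureTheory.NullSingletonClass μ] (hμ : μ (Set.Iio 0) = 0) :
    (∀ n k : ℕ, 2 ≤ n → 1 ≤ k →
      BiddingClubs.IsSymmetricEquilibrium μ (BiddingClubs.belief (βA.map Finset.card) n k)
        (fun v => BiddingClubs.bidStoch (ProbabilityTheory.cdf μ) v
          (BiddingClubs.belief (βA.map Finset.card) n k))) ∧
    BiddingClubs.IsBayesNash βC βA μ
      (fun _ => BiddingClubs.clubStrategy (ProbabilityTheory.cdf μ) (βA.map Finset.card)) :=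
  ⟨fun _ _ hn hk => BiddingClubs.isSymmetricEquilibrium_bidStoch hμ
      (BiddingClubs.exists_two_le_belief_apply_ne_zero hA0 hn hk),
    BiddingClubs.isBayesNash_clubStrategy hμ hA0 hC1⟩
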